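/- Let $n\ge 1$ be an integer. A convex body in $\mathbb R^n$ is a compact convex set with non-empty interior; $\mathcal K_0^n$ denotes the set of convex bodies in $\mathbb R^n$ that contain the origin in their interior. Let $\mathcal H^{n-1}$ be $(n-1)$-dimensional Hausdorff measure (normalized to agree with Lebesgue measure on $\mathbb R^{n-1}$). For a convex body $K$ let $h_K(u)=\max\{\langle u,y\rangle : y\in K\}$ be its support function. A unit vector $u$ is an outer unit normal of $K$ at $x\in\partial K$ if $\langle x,u\rangle=h_K(u)$; for $\beta\subset\partial K$ let $\nu(K,\beta)$ be the set of outer unit normals of $K$ at points of $\beta$, and let $\nu_K(x)$ be the outer unit normal at $x$ if it is unique (which is the case for $\mathcal H^{n-1}$-almost every $x\in\partial K$). The curvature measures $C_0(K,\cdot)$ and $C_{n-1}(K,\cdot)$ are the Borel measures on $\partial K$ given by $C_0(K,\beta)=\mathcal H^{n-1}(\nu(K,\beta))$ and $C_{n-1}(K,\beta)=\mathcal H^{n-1}(\beta)$. For a real number $p>0$ and $K\in\mathcal K_0^n$, the $L_p$ affine surface area of $K$ is $$\Omega_p(K)=\inf_{g}\left\{\left(\int_{\partial K}g(x)^{-n}\,dC_0(K,x)\right)^{\frac{p}{n+p}}\left(\int_{\partial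 K}g(x)^p\,h_K(\nu_K(x))^{1-p}\,dC_{n-1}(K,x)\right)^{\frac{n}{n+p}}\right\},$$ and the affine surface area of an arbitrary convex body $K$ in $\mathbb R^n$ is $$\Omega(K)=\inf_{g}\left\{\left(\int_{\partial K}g(x)^{-n}\,dC_0(K,x)\right)^{\frac{1}{n+1}}\left(\int_{\partial K}g(x)\,dC_{n-1}(K,x)\right)^{\frac{n}{n+1}}\right\},$$ where both infima are taken over all positive continuous functions $g:\partial K\to\mathbb R$. Then, with respect to the Hausdorff metric, for every real $p>0$ the functional $\Omega_p$ is upper semi-continuous on $\mathcal K_0^n$; moreover, in the case $p=1$, the functional $\Omega$ is upper semi-continuous on the set of all convex bodies in $\mathbb R^n$. -/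

import Mathlib

open MeasureTheory Set
open scoped RealInnerProductSpace

namespace LpAffine

/-- The support function `h_K(u) = max {⟪x, u⟫ : x ∈ K}`. -/
noncomputable def supportFunction {n : ℕ} (K : ConvexBody (EuclideanSpace ℝ (Fin n)))
    (u : EuclideanSpace ℝ (Fin n)) : ℝ :=
  sSup ((fun x => ⟪x, u⟫) '' (K : Set (EuclideanSpace ℝ (Fin n))))

/-- `u` is an outer unit normal of `K` at the boundary point `x`: the supporting hyperplane
`{y | ⟪y, u⟫ = h_K(u)}` passes through `x`. -/
def IsOuterUnitNormal {n : ℕ} (K : ConvexBody (EuclideanSpace ℝ (Fin n)))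
    (x u : EuclideanSpace ℝ (Fin n)) : Prop :=
  x ∈ frontier (K : Set (EuclideanSpace ℝ (Fin n))) ∧ ‖u‖ = 1 ∧ ⟪x, u⟫ = supportFunction K u

/-- The spherical image `ν(K, β)`: all outer unit normals of `K` at boundary points in `β`. -/
def sphericalImage {n : ℕ} (K : ConvexBody (EuclideanSpace ℝ (Fin n)))
    (β : Set (EuclideanSpace ℝ (Fin n))) : Set (EuclideanSpace ℝ (Fin n)) :=
  {u | ∃ x ∈ β, IsOuterUnitNormal K x u}

open Classical in
/-- The Gauss map `ν_K`: the unique outer unit normal at a regular boundary point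
(and `0` elsewhere; the non-regular boundary points form a null set). -/
noncomputable def gaussMap {n : ℕ} (K : ConvexBody (EuclideanSpace ℝ (Fin n)))
    (x : EuclideanSpace ℝ (Fin n)) : EuclideanSpace ℝ (Fin n) :=
  if h : ∃! u, IsOuterUnitNormal K x u then h.choose else 0

/-! ### Facts needed for the construction of the zeroth curvature measure -/

theorem exists_eq_supportFunction {n : ℕ} (K : ConvexBody (EuclideanSpace ℝ (Fin n)))
    (u : EuclideanSpace ℝ (Fin n)) :
    ∃ x ∈ K, ⟪x, u⟫ = supportFunction K u ∧ ∀ y ∈ K, ⟪y, u⟫ ≤ supportFunction K u := by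
  have hc : ContinuousOn (fun x : EuclideanSpace ℝ (Fin n) => ⟪x, u⟫) (K : Set _) := by fun_prop
  have himg := K.isCompact.image_of_continuousOn hc
  obtain ⟨x, hx, hxe⟩ := himg.sSup_mem (K.nonempty.image _)
  exact ⟨x, hx, hxe, fun y hy => le_csSup himg.bddAbove (mem_image_of_mem _ hy)⟩

theorem inner_le_supportFunction {n : ℕ} (K : ConvexBody (EuclideanSpace ℝ (Fin n)))
    (u : EuclideanSpace ℝ (Fin n)) {y : EuclideanSpace ℝ (Fin n)} (hy : y ∈ K) :
    ⟪y, u⟫ ≤ supportFunction K u := by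
  obtain ⟨_, _, _, h⟩ := exists_eq_supportFunction K u
  exact h y hy

theorem mem_of_mem_frontier {n : ℕ} (K : ConvexBody (EuclideanSpace ℝ (Fin n)))
    {x : EuclideanSpace ℝ (Fin n)}
    (hx : x ∈ frontier (K : Set (EuclideanSpace ℝ (Fin n)))) : x ∈ K :=
  K.isClosed.frontier_subset hx

theorem exists_lipschitzWith_supportFunction {n : ℕ}
    (K : ConvexBody (EuclideanSpace ℝ (Fin n))) :
    ∃ R : NNReal, LipschitzWith R (supportFunction K) := by
  obtain ⟨R, hR⟩ := K.isBounded.exists_norm_le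
  refine ⟨R.toNNReal, LipschitzWith.of_le_add_mul _ fun u v => ?_⟩
  obtain ⟨x, hx, hxu, -⟩ := exists_eq_supportFunction K u
  have h1 := inner_le_supportFunction K v hx
  have h2 : ⟪x, u - v⟫ ≤ R * ‖u - v‖ :=
    (real_inner_le_norm _ _).trans (mul_le_mul_of_nonneg_right (hR x hx) (norm_nonneg _))
  have h3 : 0 ≤ R := (norm_nonneg _).trans (hR x hx)
  rw [inner_sub_right] at h2
  rw [Real.coe_toNNReal _ h3, dist_eq_norm]
  linarith

theorem lipschitzOnWith_normalize {E : Type*} [NormedAddCommGroup E] [NormedSpace ℝ E] :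
    LipschitzOnWith 2 (fun a : E => ‖a‖⁻¹ • a) {a | 1 ≤ ‖a‖} := by
  refine LipschitzOnWith.of_dist_le_mul fun a ha b hb => ?_
  have ha' : (1 : ℝ) ≤ ‖a‖ := ha
  have hb' : (1 : ℝ) ≤ ‖b‖ := hb
  have ha0 : 0 < ‖a‖ := by linarith
  have hb0 : 0 < ‖b‖ := by linarith
  rw [dist_eq_norm, dist_eq_norm]
  have e : ‖a‖⁻¹ • a - ‖b‖⁻¹ • b = ‖a‖⁻¹ • (a - b) + (‖a‖⁻¹ * (‖b‖ - ‖a‖)) • (‖b‖⁻¹ • b) := by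
    have : ‖a‖⁻¹ * (‖b‖ - ‖a‖) * ‖b‖⁻¹ = ‖a‖⁻¹ - ‖b‖⁻¹ := by field_simp
    rw [smul_smul, this, smul_sub, sub_smul]; abel
  have hi : ‖a‖⁻¹ ≤ 1 := inv_le_one_of_one_le₀ ha'
  have hi0 : 0 ≤ ‖a‖⁻¹ := by positivity
  have h1 : ‖‖a‖⁻¹ • (a - b)‖ ≤ ‖a - b‖ := by
    rw [norm_smul, norm_inv, norm_norm]
    exact mul_le_of_le_one_left (norm_nonneg _) hi
  have h2 : ‖(‖a‖⁻¹ * (‖b‖ - ‖a‖)) • (‖b‖⁻¹ • b)‖ ≤ ‖a - b‖ := by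
    have h3 : ‖‖b‖⁻¹ • b‖ = 1 := by
      rw [norm_smul, norm_inv, norm_norm, inv_mul_cancel₀ hb0.ne']
    rw [norm_smul, h3, mul_one, norm_mul, norm_inv, norm_norm]
    refine (mul_le_of_le_one_left (norm_nonneg _) hi).trans ?_
    rw [Real.norm_eq_abs, abs_sub_comm]
    exact abs_norm_sub_norm_le a b
  rw [e]
  refine (norm_add_le _ _).trans ?_
  simp only [NNReal.coe_ofNat]
  linarith

/-- The unit vectors that are outer normals at two different boundary points. -/
def irregularNormals {n : ℕ} (K : ConvexBody (EuclideanSpace ℝ (Fin n))) :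
    Set (EuclideanSpace ℝ (Fin n)) :=
  {u | ∃ x y, x ≠ y ∧ IsOuterUnitNormal K x u ∧ IsOuterUnitNormal K y u}

theorem measure_irregularNormals_halfSpace {n : ℕ} (K : ConvexBody (EuclideanSpace ℝ (Fin n)))
    (e : EuclideanSpace ℝ (Fin n)) (he : ‖e‖ = 1) :
    μHE[n - 1] (irregularNormals K ∩ {u | 0 < ⟪e, u⟫}) = 0 := by
  have he0 : e ≠ 0 := by rintro rfl; simp at he
  have hfin : Module.finrank ℝ (ℝ ∙ e)ᗮ = n - 1 := by
    have h1 := Submodule.finrank_add_finrank_orthogonal (ℝ ∙ e)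
    rw [finrank_span_singleton he0, finrank_euclideanSpace_fin] at h1
    omega
  obtain ⟨R, hR⟩ := exists_lipschitzWith_supportFunction K
  let f : (ℝ ∙ e)ᗮ → ℝ := fun w => supportFunction K ((w : EuclideanSpace ℝ (Fin n)) + e)
  have hf : LipschitzWith R f := by
    refine LipschitzWith.of_dist_le_mul fun a b => ?_
    refine (hR.dist_le_mul _ _).trans ?_
    simp [Subtype.dist_eq]
  have hnull : μHE[n - 1] {w | ¬ DifferentiableAt ℝ f w} = 0 := by
    rw [← hfin]
    exact hf.ae_differentiableAt
  rw [Measure.euclideanHausdorffMeasure_def, Measure.smul_apply] at hnull ⊢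
  have hnull' : μH[((n - 1 : ℕ) : ℝ)] {w | ¬ DifferentiableAt ℝ f w} = 0 := by
    rcases smul_eq_zero.1 hnull with h | h
    · exact absurd h (Measure.addHaarScalarFactor_volume_hausdorffMeasure_ne_zero _)
    · exact h
  let φ : (ℝ ∙ e)ᗮ → EuclideanSpace ℝ (Fin n) := fun w => ‖(w : EuclideanSpace ℝ (Fin n)) + e‖⁻¹ •
    ((w : EuclideanSpace ℝ (Fin n)) + e)
  have hinner : ∀ w : (ℝ ∙ e)ᗮ, ⟪e, (w : EuclideanSpace ℝ (Fin n))⟫ = 0 := fun w =>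
    Submodule.mem_orthogonal_singleton_iff_inner_right.1 w.2
  have hφ : LipschitzWith 2 φ := by
    rw [← lipschitzOnWith_univ]
    have ht : LipschitzOnWith 1 (fun w : (ℝ ∙ e)ᗮ => (w : EuclideanSpace ℝ (Fin n)) + e) univ := by
      refine LipschitzOnWith.of_dist_le_mul fun a _ b _ => ?_
      simp [Subtype.dist_eq]
    have := lipschitzOnWith_normalize.comp ht (fun w _ => ?_)
    · rw [mul_one] at this
      exact this
    · have h1 := real_inner_le_norm e ((w : EuclideanSpace ℝ (Fin n)) + e)
      rw [inner_add_right, hinner, real_inner_self_eq_norm_sq, he] at h1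
      simpa using h1
  have himg : μH[((n - 1 : ℕ) : ℝ)] (φ '' {w | ¬ DifferentiableAt ℝ f w}) = 0 := by
    refine le_antisymm ((hφ.hausdorffMeasure_image_le (by positivity) _).trans ?_) zero_le
    rw [hnull', mul_zero]
  refine smul_eq_zero.2 (Or.inr (measure_mono_null ?_ himg))
  rintro u ⟨⟨x, y, hxy, ⟨hx, hu, hxu⟩, ⟨hy, -, hyu⟩⟩, hpos⟩
  have hpos' : 0 < ⟪e, u⟫ := hpos
  let t := ⟪e, u⟫⁻¹
  have ht : 0 < t := inv_pos.2 hpos'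
  have hw : t • u - e ∈ (ℝ ∙ e)ᗮ := by
    rw [Submodule.mem_orthogonal_singleton_iff_inner_right, inner_sub_right, inner_smul_right,
      real_inner_self_eq_norm_sq, he]
    simp [t, hpos'.ne']
  refine ⟨⟨t • u - e, hw⟩, ?_, ?_⟩
  swap
  · simp only [φ, sub_add_cancel, norm_smul, hu, mul_one, Real.norm_eq_abs, abs_of_pos ht,
      smul_smul, inv_mul_cancel₀ ht.ne', one_smul]
  intro hd
  have hhom : ∀ z, ⟪z, u⟫ = supportFunction K u → z ∈ K → ⟪z, t • u⟫ = supportFunction K (t • u) := by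
    intro z hz hzK
    obtain ⟨z', hz', hze, -⟩ := exists_eq_supportFunction K (t • u)
    refine le_antisymm (inner_le_supportFunction K _ hzK) ?_
    rw [← hze, inner_smul_right, inner_smul_right, hz]
    exact mul_le_mul_of_nonneg_left (inner_le_supportFunction K u hz') ht.le
  have hder : ∀ z, ⟪z, u⟫ = supportFunction K u → z ∈ K → ∀ v : (ℝ ∙ e)ᗮ,
      fderiv ℝ f ⟨t • u - e, hw⟩ v = ⟪z, (v : EuclideanSpace ℝ (Fin n))⟫ := by
    intro z hz hzK v
    let L : (ℝ ∙ e)ᗮ →L[ℝ] ℝ := (innerSL ℝ z).comp (Submodule.subtypeL _)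
    have hmin : IsLocalMin (fun w => f w - L w) ⟨t • u - e, hw⟩ := by
      refine Filter.Eventually.of_forall fun w => ?_
      have h1 := inner_le_supportFunction K ((w : EuclideanSpace ℝ (Fin n)) + e) hzK
      have h2 := hhom z hz hzK
      simp only [f, L, ContinuousLinearMap.comp_apply, Submodule.subtypeL_apply, innerSL_apply_apply,
        sub_add_cancel, inner_sub_right]
      rw [inner_add_right] at h1
      linarith
    have h0 := hmin.fderiv_eq_zero
    rw [fderiv_fun_sub hd L.differentiableAt, ContinuousLinearMap.fderiv, sub_eq_zero] at h0
    rw [h0]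
    simp [L]
  have hxK := mem_of_mem_frontier K hx
  have hyK := mem_of_mem_frontier K hy
  have h1 : ∀ v : (ℝ ∙ e)ᗮ, ⟪x - y, (v : EuclideanSpace ℝ (Fin n))⟫ = 0 := fun v => by
    rw [inner_sub_left, ← hder x hxu hxK v, ← hder y hyu hyK v, sub_self]
  have h2 : ⟪x - y, u⟫ = 0 := by rw [inner_sub_left, hxu, hyu, sub_self]
  have h3 : ⟪x - y, e⟫ = 0 := by
    have := h1 ⟨t • u - e, hw⟩
    simp only [inner_sub_right, inner_smul_right, h2, mul_zero, zero_sub, neg_eq_zero] at this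
    exact this
  have h4 : x - y ∈ (ℝ ∙ e)ᗮ :=
    Submodule.mem_orthogonal_singleton_iff_inner_left.2 h3
  exact hxy (sub_eq_zero.1 (inner_self_eq_zero.1 (h1 ⟨x - y, h4⟩)))

theorem measure_irregularNormals {n : ℕ} (K : ConvexBody (EuclideanSpace ℝ (Fin n))) :
    μHE[n - 1] (irregularNormals K) = 0 := by
  let b : Fin n → EuclideanSpace ℝ (Fin n) := fun i => EuclideanSpace.single i (1 : ℝ)
  have hb : ∀ i, ‖b i‖ = 1 := fun i => by simp [b]
  have key : μHE[n - 1] (⋃ i, (irregularNormals K ∩ {u | 0 < ⟪b i, u⟫} ∪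
      irregularNormals K ∩ {u | 0 < ⟪-b i, u⟫})) = 0 :=
    measure_iUnion_null fun i => measure_union_null
      (measure_irregularNormals_halfSpace K _ (hb i))
      (measure_irregularNormals_halfSpace K _ (by rw [norm_neg, hb i]))
  refine measure_mono_null (fun u hu => ?_) key
  have hu1 : ‖u‖ = 1 := by
    obtain ⟨x, y, -, h, -⟩ := hu
    exact h.2.1
  have hex : ∃ i, u i ≠ 0 := by
    by_contra! h
    have : u = 0 := by ext i; exact h i
    simp [this] at hu1
  obtain ⟨i, hi⟩ := hex
  have hbi : ⟪b i, u⟫ = u i := by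
    have := EuclideanSpace.inner_single_left i (1 : ℝ) u
    simpa [b] using this
  refine mem_iUnion.2 ⟨i, ?_⟩
  rcases lt_or_gt_of_ne hi with h | h
  · refine Or.inr ⟨hu, ?_⟩
    simp only [mem_ofPred_eq, inner_neg_left, hbi]
    linarith
  · exact Or.inl ⟨hu, by simpa only [mem_ofPred_eq, hbi] using h⟩

theorem isClosed_sphericalImage {n : ℕ} (K : ConvexBody (EuclideanSpace ℝ (Fin n)))
    {β : Set (EuclideanSpace ℝ (Fin n))} (hβ : IsClosed β) :
    IsClosed (sphericalImage K β) := by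
  obtain ⟨R, hR⟩ := exists_lipschitzWith_supportFunction K
  have hcont := hR.continuous
  have h1 : IsCompact (β ∩ frontier (K : Set (EuclideanSpace ℝ (Fin n)))) :=
    (K.isCompact.of_isClosed_subset isClosed_frontier K.isClosed.frontier_subset).inter_left hβ
  have h2 := h1.prod (isCompact_sphere (0 : EuclideanSpace ℝ (Fin n)) 1)
  have h3 : IsClosed {q : EuclideanSpace ℝ (Fin n) × EuclideanSpace ℝ (Fin n) |
      ⟪q.1, q.2⟫ = supportFunction K q.2} :=
    isClosed_eq (by fun_prop) (by fun_prop)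
  have h4 := ((h2.inter_right h3).image continuous_snd).isClosed
  refine Eq.mpr (congrArg IsClosed (Set.ext fun u => ?_)) h4
  constructor
  · rintro ⟨x, hx, hxf, hu, hxu⟩
    exact ⟨(x, u), ⟨⟨⟨hx, hxf⟩, by simpa using hu⟩, hxu⟩, rfl⟩
  · rintro ⟨⟨x, v⟩, ⟨⟨⟨hx, hxf⟩, hv⟩, hxu⟩, rfl⟩
    exact ⟨x, hx, hxf, by simpa using hv, hxu⟩

/-- The set function `β ↦ ℋⁿ⁻¹(ν(K, β))` on all subsets. -/
noncomputable def curvatureOuterMeasureZero {n : ℕ}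
    (K : ConvexBody (EuclideanSpace ℝ (Fin n))) : OuterMeasure (EuclideanSpace ℝ (Fin n)) where
  measureOf β := μHE[n - 1] (sphericalImage K β)
  empty := by simp [sphericalImage]
  mono := fun {s t} hst => measure_mono (by rintro u ⟨x, hx, h⟩; exact ⟨x, hst hx, h⟩)
  iUnion_nat := fun s _ => by
    refine (measure_mono ?_).trans (measure_iUnion_le _)
    rintro u ⟨x, hx, h⟩
    obtain ⟨i, hi⟩ := mem_iUnion.1 hx
    exact mem_iUnion.2 ⟨i, x, hi, h⟩

theorem borel_le_caratheodory {n : ℕ} (K : ConvexBody (EuclideanSpace ℝ (Fin n))) :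
    (inferInstance : MeasurableSpace (EuclideanSpace ℝ (Fin n))) ≤
      (curvatureOuterMeasureZero K).caratheodory := by
  rw [BorelSpace.measurable_eq (α := EuclideanSpace ℝ (Fin n)), borel_eq_generateFrom_isClosed]
  refine MeasurableSpace.generateFrom_le fun β hβ => ?_
  rw [OuterMeasure.isCaratheodory_iff_le]
  intro A
  change μHE[n - 1] (sphericalImage K (A ∩ β)) + μHE[n - 1] (sphericalImage K (A \ β)) ≤
    μHE[n - 1] (sphericalImage K A)
  have hm : MeasurableSet (sphericalImage K β) := (isClosed_sphericalImage K hβ).measurableSet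
  rw [← measure_inter_add_sdiff (sphericalImage K A) hm]
  refine add_le_add (measure_mono ?_) ?_
  · rintro u ⟨x, hx, h⟩
    exact ⟨⟨x, hx.1, h⟩, ⟨x, hx.2, h⟩⟩
  · calc μHE[n - 1] (sphericalImage K (A \ β))
        ≤ μHE[n - 1] (sphericalImage K A \ sphericalImage K β ∪ irregularNormals K) := by
          refine measure_mono ?_
          rintro u ⟨x, hx, h⟩
          by_cases hu : u ∈ sphericalImage K β
          · obtain ⟨y, hy, h'⟩ := hu
            exact Or.inr ⟨x, y, fun hxy => hx.2 (hxy ▸ hy), h, h'⟩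
          · exact Or.inl ⟨⟨x, hx.1, h⟩, hu⟩
      _ ≤ _ := (measure_union_le _ _).trans (by rw [measure_irregularNormals, add_zero])

/-- The zeroth curvature measure `C₀(K, β) = ℋⁿ⁻¹(ν(K, β))`, as a Borel measure on `ℝⁿ`
concentrated on `∂K`. -/
noncomputable def curvatureMeasureZero {n : ℕ} (K : ConvexBody (EuclideanSpace ℝ (Fin n))) :
    Measure (EuclideanSpace ℝ (Fin n)) :=
  (curvatureOuterMeasureZero K).toMeasure (borel_le_caratheodory K)

theorem curvatureMeasureZero_apply {n : ℕ} (K : ConvexBody (EuclideanSpace ℝ (Fin n)))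
    {β : Set (EuclideanSpace ℝ (Fin n))} (hβ : MeasurableSet β) :
    curvatureMeasureZero K β = μHE[n - 1] (sphericalImage K β) :=
  toMeasure_apply _ _ hβ

/-- The `(n-1)`-th curvature measure `C_{n-1}(K, β) = ℋⁿ⁻¹(β)`, `β ⊆ ∂K`, as a Borel measure
on `ℝⁿ` concentrated on `∂K`. -/
noncomputable def curvatureMeasureTop {n : ℕ} (K : ConvexBody (EuclideanSpace ℝ (Fin n))) :
    Measure (EuclideanSpace ℝ (Fin n)) :=
  (μHE[n - 1]).restrict (frontier (K : Set (EuclideanSpace ℝ (Fin n))))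

/-- Positive continuous functions on `∂K` (represented by functions on `ℝⁿ`, of which only the
restriction to `∂K` matters). -/
def IsPositiveContinuous {n : ℕ} (K : ConvexBody (EuclideanSpace ℝ (Fin n)))
    (g : EuclideanSpace ℝ (Fin n) → ℝ) : Prop :=
  ContinuousOn g (frontier (K : Set (EuclideanSpace ℝ (Fin n)))) ∧
    ∀ x ∈ frontier (K : Set (EuclideanSpace ℝ (Fin n))), 0 < g x

/-- The `L_p` affine surface area `Ω_p(K)`. -/
noncomputable def lpAffineSurfaceArea {n : ℕ} (p : ℝ)
    (K : ConvexBody (EuclideanSpace ℝ (Fin n))) : ℝ :=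
  ⨅ g : {g : EuclideanSpace ℝ (Fin n) → ℝ // IsPositiveContinuous K g},
    (∫ x in frontier (K : Set (EuclideanSpace ℝ (Fin n))),
        g.1 x ^ (-(n : ℝ)) ∂(curvatureMeasureZero K)) ^ (p / (n + p)) *
    (∫ x in frontier (K : Set (EuclideanSpace ℝ (Fin n))),
        g.1 x ^ p * supportFunction K (gaussMap K x) ^ (1 - p) ∂(curvatureMeasureTop K)) ^
      ((n : ℝ) / (n + p))

/-- The affine surface area `Ω(K)`. -/
noncomputable def affineSurfaceArea {n : ℕ} (K : ConvexBody (EuclideanSpace ℝ (Fin n))) : ℝ :=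
  ⨅ g : {g : EuclideanSpace ℝ (Fin n) → ℝ // IsPositiveContinuous K g},
    (∫ x in frontier (K : Set (EuclideanSpace ℝ (Fin n))),
        g.1 x ^ (-(n : ℝ)) ∂(curvatureMeasureZero K)) ^ (1 / ((n : ℝ) + 1)) *
    (∫ x in frontier (K : Set (EuclideanSpace ℝ (Fin n))),
        g.1 x ∂(curvatureMeasureTop K)) ^ ((n : ℝ) / (n + 1))

end LpAffine

/-!
An infimum of upper semicontinuous functions is upper semicontinuous, but the test functions `g`
live on the boundary `∂K`, which varies with `K`. By Tietze's theorem a nearly optimal `g` for `K`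
extends to a positive continuous function on the whole space, which is a test function for all
bodies at once. It remains to see that for this fixed `g` neither integral can jump up when bodies
`L` converge to `K` (`upperSemicontinuousOn_iInf_mul_rpow`).

*The integral against `C₀`.* The measure `C₀(K, ·)` is the image of surface measure on the sphere
under the map sending `u` to the boundary point with normal `u`, which is unique for almost every
`u` (`curvatureMeasureZero_eq_map`). These support points converge at every `u` that is regular for
the limit body, so the integral converges by dominated convergence
(`tendsto_setIntegral_curvatureMeasureZero`).

*The integral against `C_{n-1}`.* No area formula is needed. For `z` in the interior of `K`, a body
`L` near `K` lies in the dilate `z + c (K - z)` with `c` near `1`. Dilating `∂K` and then projecting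
metrically onto `L` is a `c`-Lipschitz map `T` close to the identity whose image contains `∂L`, so
surface measure on `∂L` is at most `c ^ (n - 1)` times the image under `T` of surface measure on
`∂K` (`restrict_frontier_le_map`). This pulls the integrals over `∂L` back to the fixed set `∂K`,
where dominated convergence applies (`eventually_setIntegral_frontier_lt`). Outer normals of `L` at
`T x` converge to `ν_K(x)` at every `x ∈ ∂K` with a unique normal, because limits of normals are
normals (`tendsto_normal`), and with them the weights `h_L`. Almost every boundary point is of this
kind: passing to the polar body turns points with several normals into normals with several points
(`measure_irregularPoints`).
-/

namespace LpAffine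

open Filter Topology

variable {n : ℕ}

/-! ### Metric projection onto a convex body -/

theorem exists_inner_sub_le_zero (K : ConvexBody (EuclideanSpace ℝ (Fin n)))
    (x : EuclideanSpace ℝ (Fin n)) : ∃ y ∈ K, ∀ w ∈ K, ⟪x - y, w - y⟫ ≤ 0 := by
  obtain ⟨y, hy, h⟩ := exists_norm_eq_iInf_of_complete_convex K.nonempty K.isClosed.isComplete
    K.convex x
  exact ⟨y, hy, (norm_eq_iInf_iff_real_inner_le_zero K.convex hy).1 h⟩

/-- The metric projection onto `K`: the point of `K` nearest to `x`, singled out by its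
variational inequality `⟪x - y, w - y⟫ ≤ 0` for all `w ∈ K`. -/
noncomputable def metricProj (K : ConvexBody (EuclideanSpace ℝ (Fin n)))
    (x : EuclideanSpace ℝ (Fin n)) : EuclideanSpace ℝ (Fin n) :=
  (exists_inner_sub_le_zero K x).choose

theorem metricProj_mem (K : ConvexBody (EuclideanSpace ℝ (Fin n)))
    (x : EuclideanSpace ℝ (Fin n)) : metricProj K x ∈ K :=
  (exists_inner_sub_le_zero K x).choose_spec.1

theorem inner_sub_metricProj_le (K : ConvexBody (EuclideanSpace ℝ (Fin n)))
    (x : EuclideanSpace ℝ (Fin n)) {w : EuclideanSpace ℝ (Fin n)} (hw : w ∈ K) :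
    ⟪x - metricProj K x, w - metricProj K x⟫ ≤ 0 :=
  (exists_inner_sub_le_zero K x).choose_spec.2 w hw

/-- Two points satisfying the variational inequality are at most as far apart as the points they
are projections of. -/
theorem norm_sub_le_of_inner_le {x x' y y' : EuclideanSpace ℝ (Fin n)}
    (h : ⟪x - y, y' - y⟫ ≤ 0) (h' : ⟪x' - y', y - y'⟫ ≤ 0) : ‖y - y'‖ ≤ ‖x - x'‖ := by
  have e : ‖y - y'‖ * ‖y - y'‖ - ⟪x - x', y - y'⟫ = ⟪x - y, y' - y⟫ + ⟪x' - y', y - y'⟫ := by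
    rw [← real_inner_self_eq_norm_mul_norm]
    simp only [inner_sub_left, inner_sub_right, real_inner_comm]
    ring
  have h1 := real_inner_le_norm (x - x') (y - y')
  rcases (norm_nonneg (y - y')).eq_or_lt' with h0 | h0
  · rw [h0]; exact norm_nonneg _
  · exact le_of_mul_le_mul_right (by linarith) h0

theorem metricProj_eq {K : ConvexBody (EuclideanSpace ℝ (Fin n))}
    {x y : EuclideanSpace ℝ (Fin n)} (hy : y ∈ K) (h : ∀ w ∈ K, ⟪x - y, w - y⟫ ≤ 0) :
    metricProj K x = y := by
  have := norm_sub_le_of_inner_le (inner_sub_metricProj_le K x hy) (h _ (metricProj_mem K x))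
  simpa [sub_eq_zero] using this

theorem metricProj_of_mem {K : ConvexBody (EuclideanSpace ℝ (Fin n))}
    {x : EuclideanSpace ℝ (Fin n)} (hx : x ∈ K) : metricProj K x = x :=
  metricProj_eq hx (by simp)

theorem lipschitzWith_metricProj (K : ConvexBody (EuclideanSpace ℝ (Fin n))) :
    LipschitzWith 1 (metricProj K) := by
  refine LipschitzWith.of_dist_le_mul fun x x' => ?_
  rw [dist_eq_norm, dist_eq_norm, NNReal.coe_one, one_mul]
  exact norm_sub_le_of_inner_le (inner_sub_metricProj_le K x (metricProj_mem K x'))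
    (inner_sub_metricProj_le K x' (metricProj_mem K x))

/-! ### Outer unit normals -/

/-- A point of `K` at which a nonzero linear functional attains its maximum is automatically a
boundary point. -/
theorem isOuterUnitNormal_iff {K : ConvexBody (EuclideanSpace ℝ (Fin n))}
    {x u : EuclideanSpace ℝ (Fin n)} :
    IsOuterUnitNormal K x u ↔ x ∈ K ∧ ‖u‖ = 1 ∧ ⟪x, u⟫ = supportFunction K u := by
  refine ⟨fun h => ⟨mem_of_mem_frontier K h.1, h.2⟩, fun h => ⟨?_, h.2⟩⟩
  obtain ⟨hx, hu, hxu⟩ := h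
  refine ⟨subset_closure hx, fun hint => ?_⟩
  have hc : ContinuousAt (fun t : ℝ => x + t • u) 0 := by fun_prop
  have hev : ∀ᶠ t : ℝ in 𝓝 0, x + t • u ∈ interior (K : Set (EuclideanSpace ℝ (Fin n))) :=
    hc.eventually_mem (isOpen_interior.mem_nhds (by simpa using hint))
  obtain ⟨ε, hε, hball⟩ := Metric.eventually_nhds_iff.1 hev
  have hmem := interior_subset (hball (y := ε / 2)
    (by rw [Real.dist_eq, sub_zero, abs_of_pos (by positivity)]; linarith))
  have := inner_le_supportFunction K u hmem
  rw [inner_add_left, real_inner_smul_left, real_inner_self_eq_norm_sq, hu, ← hxu] at this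
  linarith

/-- Supporting hyperplanes exist at all boundary points. -/
theorem exists_isOuterUnitNormal {K : ConvexBody (EuclideanSpace ℝ (Fin n))}
    (hK : (interior (K : Set (EuclideanSpace ℝ (Fin n)))).Nonempty)
    {x : EuclideanSpace ℝ (Fin n)} (hx : x ∈ frontier (K : Set (EuclideanSpace ℝ (Fin n)))) :
    ∃ u, IsOuterUnitNormal K x u := by
  obtain ⟨f, hf⟩ := geometric_hahn_banach_open_point K.convex.interior isOpen_interior hx.2
  let v := (InnerProductSpace.toDual ℝ (EuclideanSpace ℝ (Fin n))).symm f
  have hv : ∀ y, f y = ⟪y, v⟫ := fun y => by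
    rw [real_inner_comm, InnerProductSpace.toDual_symm_apply]
  have hv0 : v ≠ 0 := by
    intro h0
    obtain ⟨z, hz⟩ := hK
    have := hf z hz
    simp [hv, h0] at this
  have hle : ∀ y ∈ K, f y ≤ f x := by
    intro y hy
    have hcl : y ∈ closure (interior (K : Set (EuclideanSpace ℝ (Fin n)))) := by
      rw [K.convex.closure_interior_eq_closure_of_nonempty_interior hK]
      exact subset_closure hy
    exact closure_minimal (fun a ha => (hf a ha).le)
      (isClosed_le f.continuous continuous_const) hcl
  have hn : 0 < ‖v‖ := norm_pos_iff.2 hv0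
  refine ⟨‖v‖⁻¹ • v, hx, by rw [norm_smul, norm_inv, norm_norm, inv_mul_cancel₀ hn.ne'], ?_⟩
  obtain ⟨y, hy, hye, -⟩ := exists_eq_supportFunction K (‖v‖⁻¹ • v)
  refine le_antisymm (inner_le_supportFunction K _ (mem_of_mem_frontier K hx)) ?_
  rw [← hye, inner_smul_right, inner_smul_right, ← hv, ← hv]
  exact mul_le_mul_of_nonneg_left (hle y hy) (by positivity)

theorem IsOuterUnitNormal.inner_sub_le {K : ConvexBody (EuclideanSpace ℝ (Fin n))}
    {x u : EuclideanSpace ℝ (Fin n)} (h : IsOuterUnitNormal K x u)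
    {w : EuclideanSpace ℝ (Fin n)} (hw : w ∈ K) : ⟪u, w - x⟫ ≤ 0 := by
  rw [inner_sub_right, real_inner_comm, real_inner_comm x, h.2.2]
  linarith [inner_le_supportFunction K u hw]

/-- If `K` lies in the dilate of `L` by `c` about `z`, then projecting the boundary of that dilate
onto `K` covers `∂K`: an outer normal ray of `K` leaves the dilate somewhere. -/
theorem frontier_subset_image_metricProj {K L : ConvexBody (EuclideanSpace ℝ (Fin n))}
    (hK : (interior (K : Set (EuclideanSpace ℝ (Fin n)))).Nonempty)
    {c : ℝ} (hc : 0 < c) (z : EuclideanSpace ℝ (Fin n))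
    (h : ∀ y ∈ K, ∃ x ∈ L, y = z + c • (x - z)) :
    frontier (K : Set (EuclideanSpace ℝ (Fin n))) ⊆
      (fun x => metricProj K (z + c • (x - z))) '' frontier (L : Set (EuclideanSpace ℝ (Fin n))) := by
  intro y hy
  obtain ⟨u, hu⟩ := exists_isOuterUnitNormal hK hy
  let f : ℝ → EuclideanSpace ℝ (Fin n) := fun t => z + c⁻¹ • (y + |t| • u - z)
  have hfc : Continuous f := by fun_prop
  have hf : ∀ t, z + c • (f t - z) = y + |t| • u := fun t => by
    simp [f, smul_smul, hc.ne']
  have hne : (frontier (f ⁻¹' (L : Set (EuclideanSpace ℝ (Fin n))))).Nonempty := by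
    rw [nonempty_frontier_iff]
    constructor
    · obtain ⟨x, hx, hxy⟩ := h y (mem_of_mem_frontier K hy)
      refine ⟨0, ?_⟩
      have : f 0 = x := by simp [f, hxy, smul_smul, hc.ne']
      rw [mem_preimage, this]
      exact hx
    · intro huniv
      obtain ⟨R, hR⟩ := L.isBounded.exists_norm_le
      have hR0 : 0 ≤ R := (norm_nonneg _).trans (hR (f 0) (by
        have : (0 : ℝ) ∈ f ⁻¹' (L : Set (EuclideanSpace ℝ (Fin n))) := huniv ▸ mem_univ _
        exact this))
      let t := ‖y‖ + ‖z‖ + c * (R + ‖z‖) + 1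
      have ht : 0 < t := by positivity
      have hmem : t ∈ f ⁻¹' (L : Set (EuclideanSpace ℝ (Fin n))) := huniv ▸ mem_univ _
      have h1 := hR _ hmem
      have h2 : t • u = z + c • (f t - z) - y := by rw [hf, abs_of_pos ht]; abel
      have h3 : t = ‖z + c • (f t - z) - y‖ := by
        rw [← h2, norm_smul, hu.2.1, mul_one, Real.norm_of_nonneg ht.le]
      have h4 : ‖z + c • (f t - z) - y‖ ≤ ‖z‖ + c * (R + ‖z‖) + ‖y‖ := by
        refine (norm_sub_le _ _).trans (add_le_add_left ((norm_add_le _ _).trans ?_) _)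
        rw [norm_smul, Real.norm_of_nonneg hc.le]
        gcongr
        exact (norm_sub_le _ _).trans (add_le_add_left h1 _)
      have h5 : t = ‖y‖ + ‖z‖ + c * (R + ‖z‖) + 1 := rfl
      linarith
  obtain ⟨t, ht⟩ := hne
  refine ⟨f t, hfc.frontier_preimage_subset _ ht, ?_⟩
  simp only [hf]
  refine metricProj_eq (mem_of_mem_frontier K hy) fun w hw => ?_
  rw [add_sub_cancel_left, real_inner_smul_left]
  exact mul_nonpos_of_nonneg_of_nonpos (abs_nonneg _) (hu.inner_sub_le hw)

/-! ### Continuity with respect to the Hausdorff metric -/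

theorem exists_dist_le_dist {K L : ConvexBody (EuclideanSpace ℝ (Fin n))}
    {x : EuclideanSpace ℝ (Fin n)} (hx : x ∈ K) : ∃ y ∈ L, dist x y ≤ dist K L := by
  obtain ⟨y, hy, h⟩ := L.isCompact.exists_infDist_eq_dist L.nonempty x
  refine ⟨y, hy, h ▸ ?_⟩
  exact Metric.infDist_le_hausdorffDist_of_mem hx ConvexBody.hausdorffEDist_ne_top

theorem supportFunction_le_add (K L : ConvexBody (EuclideanSpace ℝ (Fin n)))
    (u : EuclideanSpace ℝ (Fin n)) :
    supportFunction K u ≤ supportFunction L u + dist K L * ‖u‖ := by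
  obtain ⟨x, hx, hxe, -⟩ := exists_eq_supportFunction K u
  obtain ⟨y, hy, hxy⟩ := exists_dist_le_dist (L := L) hx
  have h1 := inner_le_supportFunction L u hy
  have h2 : ⟪x - y, u⟫ ≤ dist K L * ‖u‖ := by
    refine (real_inner_le_norm _ _).trans ?_
    rw [← dist_eq_norm]
    gcongr
  rw [inner_sub_left] at h2
  linarith

theorem tendsto_supportFunction {ι : Type*} {l : Filter ι}
    {L : ι → ConvexBody (EuclideanSpace ℝ (Fin n))} {K : ConvexBody (EuclideanSpace ℝ (Fin n))}
    {v : ι → EuclideanSpace ℝ (Fin n)} {u : EuclideanSpace ℝ (Fin n)}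
    (hL : Tendsto L l (𝓝 K)) (hv : Tendsto v l (𝓝 u)) :
    Tendsto (fun i => supportFunction (L i) (v i)) l (𝓝 (supportFunction K u)) := by
  obtain ⟨R, hR⟩ := exists_lipschitzWith_supportFunction K
  have h1 : Tendsto (fun i => supportFunction K (v i)) l (𝓝 (supportFunction K u)) :=
    (hR.continuous.tendsto u).comp hv
  have h2 : Tendsto (fun i => dist (L i) K * ‖v i‖) l (𝓝 0) := by
    simpa using (tendsto_iff_dist_tendsto_zero.1 hL).mul hv.norm
  refine tendsto_of_tendsto_of_tendsto_of_le_of_le (by simpa using h1.sub h2)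
    (by simpa using h1.add h2) (fun i => ?_) (fun i => supportFunction_le_add (L i) K (v i))
  have := supportFunction_le_add K (L i) (v i)
  rw [dist_comm] at this
  simp only
  linarith

theorem mem_of_tendsto_convexBody {ι : Type*} {l : Filter ι} [l.NeBot]
    {L : ι → ConvexBody (EuclideanSpace ℝ (Fin n))} {K : ConvexBody (EuclideanSpace ℝ (Fin n))}
    {y : ι → EuclideanSpace ℝ (Fin n)} {x : EuclideanSpace ℝ (Fin n)}
    (hL : Tendsto L l (𝓝 K)) (hy : Tendsto y l (𝓝 x)) (hmem : ∀ᶠ i in l, y i ∈ L i) : x ∈ K := by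
  have h0 : Tendsto (fun i => dist (L i) K + dist (y i) x) l (𝓝 0) := by
    simpa using (tendsto_iff_dist_tendsto_zero.1 hL).add (tendsto_iff_dist_tendsto_zero.1 hy)
  have hle : Metric.infDist x (K : Set (EuclideanSpace ℝ (Fin n))) ≤ 0 := by
    refine ge_of_tendsto h0 (hmem.mono fun i hi => ?_)
    obtain ⟨k, hk, hd⟩ := exists_dist_le_dist (L := K) hi
    refine (Metric.infDist_le_dist_of_mem hk).trans ?_
    linarith [dist_triangle x (y i) k, dist_comm x (y i)]
  exact (K.isClosed.mem_iff_infDist_zero K.nonempty).2 (le_antisymm hle Metric.infDist_nonneg)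

/-- The normal bundle depends closedly on the convex body. -/
theorem isOuterUnitNormal_of_tendsto {ι : Type*} {l : Filter ι} [l.NeBot]
    {L : ι → ConvexBody (EuclideanSpace ℝ (Fin n))} {K : ConvexBody (EuclideanSpace ℝ (Fin n))}
    {y v : ι → EuclideanSpace ℝ (Fin n)} {x u : EuclideanSpace ℝ (Fin n)}
    (hL : Tendsto L l (𝓝 K)) (hy : Tendsto y l (𝓝 x)) (hv : Tendsto v l (𝓝 u))
    (h : ∀ᶠ i in l, IsOuterUnitNormal (L i) (y i) (v i)) : IsOuterUnitNormal K x u := by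
  rw [isOuterUnitNormal_iff]
  refine ⟨mem_of_tendsto_convexBody hL hy (h.mono fun i hi => mem_of_mem_frontier _ hi.1), ?_, ?_⟩
  · exact tendsto_nhds_unique_of_eventuallyEq hv.norm tendsto_const_nhds (h.mono fun i hi => hi.2.1)
  · exact tendsto_nhds_unique_of_eventuallyEq (hy.inner hv) (tendsto_supportFunction hL hv)
      (h.mono fun i hi => hi.2.2)

/-- Outer normals at points converging to a regular boundary point converge. -/
theorem tendsto_normal {ι : Type*} {l : Filter ι}
    {L : ι → ConvexBody (EuclideanSpace ℝ (Fin n))} {K : ConvexBody (EuclideanSpace ℝ (Fin n))}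
    {y v : ι → EuclideanSpace ℝ (Fin n)} {x u : EuclideanSpace ℝ (Fin n)}
    (hL : Tendsto L l (𝓝 K)) (hy : Tendsto y l (𝓝 x))
    (h : ∀ᶠ i in l, IsOuterUnitNormal (L i) (y i) (v i))
    (huniq : ∀ w, IsOuterUnitNormal K x w → w = u) : Tendsto v l (𝓝 u) := by
  refine (isCompact_sphere (0 : EuclideanSpace ℝ (Fin n)) 1).tendsto_nhds_of_unique_mapClusterPt
    (h.mono fun i hi => by simpa using hi.2.1) fun w _ hw => ?_
  obtain ⟨U, hU, hUw⟩ := mapClusterPt_iff_ultrafilter.1 hw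
  exact huniq w (isOuterUnitNormal_of_tendsto (hL.mono_left hU) (hy.mono_left hU) hUw
    (h.filter_mono hU))

theorem exists_eventually_norm_le {ι : Type*} {l : Filter ι}
    {L : ι → ConvexBody (EuclideanSpace ℝ (Fin n))} {K : ConvexBody (EuclideanSpace ℝ (Fin n))}
    (hL : Tendsto L l (𝓝 K)) : ∃ R : ℝ, ∀ᶠ i in l, ∀ x ∈ L i, ‖x‖ ≤ R := by
  obtain ⟨R, hR⟩ := K.isBounded.exists_norm_le
  refine ⟨R + 1, (hL.eventually (Metric.ball_mem_nhds K one_pos)).mono fun i hi x hx => ?_⟩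
  obtain ⟨y, hy, hxy⟩ := exists_dist_le_dist (L := K) hx
  have h1 : dist (L i) K < 1 := hi
  have h2 := hR y hy
  have h3 := norm_le_norm_add_norm_sub' x y
  rw [← dist_eq_norm] at h3
  linarith

/-- Boundary points with normals converging to a regular normal converge. -/
theorem tendsto_supportPoint {ι : Type*} {l : Filter ι}
    {L : ι → ConvexBody (EuclideanSpace ℝ (Fin n))} {K : ConvexBody (EuclideanSpace ℝ (Fin n))}
    {y v : ι → EuclideanSpace ℝ (Fin n)} {x u : EuclideanSpace ℝ (Fin n)}
    (hL : Tendsto L l (𝓝 K)) (hv : Tendsto v l (𝓝 u))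
    (h : ∀ᶠ i in l, IsOuterUnitNormal (L i) (y i) (v i))
    (huniq : ∀ w, IsOuterUnitNormal K w u → w = x) : Tendsto y l (𝓝 x) := by
  obtain ⟨R, hR⟩ := exists_eventually_norm_le hL
  refine (isCompact_closedBall (0 : EuclideanSpace ℝ (Fin n))
    R).tendsto_nhds_of_unique_mapClusterPt ?_ fun w _ hw => ?_
  · filter_upwards [h, hR] with i hi hi'
    simpa using hi' _ (mem_of_mem_frontier _ hi.1)
  obtain ⟨U, hU, hUw⟩ := mapClusterPt_iff_ultrafilter.1 hw
  exact huniq w (isOuterUnitNormal_of_tendsto (hL.mono_left hU) hUw (hv.mono_left hU)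
    (h.filter_mono hU))

/-- If `K` contains the ball of radius `r` about `z`, a body `L` at Hausdorff distance `d` lies in
the dilate of `K` about `z` by the factor `1 + d / r`. -/
theorem exists_eq_add_smul_of_mem {K L : ConvexBody (EuclideanSpace ℝ (Fin n))}
    {z : EuclideanSpace ℝ (Fin n)} {r : ℝ} (hr : 0 < r)
    (hball : Metric.closedBall z r ⊆ (K : Set (EuclideanSpace ℝ (Fin n))))
    {y : EuclideanSpace ℝ (Fin n)} (hy : y ∈ L) :
    ∃ x ∈ K, y = z + (1 + dist L K / r) • (x - z) := by
  obtain ⟨k, hk, hd⟩ := exists_dist_le_dist (L := K) hy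
  rcases (dist_nonneg (x := L) (y := K)).eq_or_lt with h0 | h0
  · have : y = k := dist_le_zero.1 (h0 ▸ hd)
    exact ⟨k, hk, by simp [← h0, this]⟩
  set d := dist L K with hddef
  have hw : z + (r / d) • (y - k) ∈ (K : Set (EuclideanSpace ℝ (Fin n))) := by
    apply hball
    rw [mem_closedBall_iff_norm, add_sub_cancel_left, norm_smul, Real.norm_of_nonneg (by positivity),
      ← dist_eq_norm]
    calc r / d * dist y k ≤ r / d * d := by gcongr
      _ = r := by field_simp
  have hs : 0 < 1 + d / r := by positivity
  refine ⟨(1 + d / r)⁻¹ • k + ((1 + d / r)⁻¹ * (d / r)) • (z + (r / d) • (y - k)),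
    K.convex hk hw (by positivity) (by positivity) (by field_simp), ?_⟩
  have e : (1 + d / r) • ((1 + d / r)⁻¹ • k + ((1 + d / r)⁻¹ * (d / r)) •
      (z + (r / d) • (y - k))) = y + (d / r) • z := by
    rw [smul_add, smul_smul, smul_smul, mul_inv_cancel₀ hs.ne', mul_inv_cancel_left₀ hs.ne',
      smul_add, smul_smul, div_mul_div_cancel₀ hr.ne', div_self h0.ne', one_smul, one_smul]
    abel
  rw [smul_sub, e, add_smul, one_smul]
  abel

/-- Dilating about `z` by factors tending to `1` and projecting onto bodies converging to `K`
moves a point of `K` only a little. -/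
theorem tendsto_metricProj_dilate {ι : Type*} {l : Filter ι}
    {L : ι → ConvexBody (EuclideanSpace ℝ (Fin n))} {K : ConvexBody (EuclideanSpace ℝ (Fin n))}
    (hL : Tendsto L l (𝓝 K)) (z : EuclideanSpace ℝ (Fin n)) {c : ι → ℝ} (hc : Tendsto c l (𝓝 1))
    {x : EuclideanSpace ℝ (Fin n)} (hx : x ∈ K) :
    Tendsto (fun i => metricProj (L i) (z + c i • (x - z))) l (𝓝 x) := by
  have h1 : Tendsto (fun i => z + c i • (x - z)) l (𝓝 x) := by
    simpa using (hc.smul_const (x - z)).const_add z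
  have h2 : Tendsto (fun i => dist (z + c i • (x - z)) x + (dist (L i) K + dist (L i) K)) l
      (𝓝 0) := by
    have h := tendsto_iff_dist_tendsto_zero.1 hL
    simpa using (tendsto_iff_dist_tendsto_zero.1 h1).add (h.add h)
  refine tendsto_iff_dist_tendsto_zero.2 (squeeze_zero (fun _ => dist_nonneg) (fun i => ?_) h2)
  obtain ⟨y, hy, hxy⟩ := exists_dist_le_dist (L := L i) hx
  rw [dist_comm K] at hxy
  have h3 := (lipschitzWith_metricProj (L i)).dist_le_mul (z + c i • (x - z)) y
  rw [metricProj_of_mem hy, NNReal.coe_one, one_mul] at h3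
  have h4 := dist_triangle (metricProj (L i) (z + c i • (x - z))) y x
  have h5 := dist_triangle (z + c i • (x - z)) x y
  rw [dist_comm y] at h4
  linarith

/-! ### Hausdorff measure of boundaries -/

theorem euclideanHausdorffMeasure_image_le {X Y : Type*} [MetricSpace X] [MeasurableSpace X]
    [BorelSpace X] [MetricSpace Y] [MeasurableSpace Y] [BorelSpace Y] {f : X → Y} {s : Set X}
    {c : NNReal} (h : LipschitzOnWith c f s) (d : ℕ) :
    μHE[d] (f '' s) ≤ (c ^ d : NNReal) * μHE[d] s := by
  rw [Measure.euclideanHausdorffMeasure_def, Measure.euclideanHausdorffMeasure_def,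
    Measure.smul_apply, Measure.smul_apply]
  have := h.hausdorffMeasure_image_le (d := d) (by positivity)
  rw [ENNReal.rpow_natCast] at this
  simp only [ENNReal.smul_def, smul_eq_mul, ENNReal.coe_pow]
  rw [mul_left_comm]
  gcongr

/-- The sphere is covered locally by bounded pieces of hyperplanes, projected radially. -/
theorem measure_sphere_lt_top :
    μHE[n - 1] (Metric.sphere (0 : EuclideanSpace ℝ (Fin n)) 1) < ⊤ := by
  refine (isCompact_sphere 0 1).measure_lt_top_of_nhdsWithin fun e he => ?_
  have he : ‖e‖ = 1 := by simpa using he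
  have he0 : e ≠ 0 := by rintro rfl; simp at he
  have hfin : Module.finrank ℝ (ℝ ∙ e)ᗮ = n - 1 := by
    have h1 := Submodule.finrank_add_finrank_orthogonal (ℝ ∙ e)
    rw [finrank_span_singleton he0, finrank_euclideanSpace_fin] at h1
    omega
  have hinner : ∀ w : (ℝ ∙ e)ᗮ, ⟪e, (w : EuclideanSpace ℝ (Fin n))⟫ = 0 := fun w =>
    Submodule.mem_orthogonal_singleton_iff_inner_right.1 w.2
  let φ : (ℝ ∙ e)ᗮ → EuclideanSpace ℝ (Fin n) := fun w => ‖(w : EuclideanSpace ℝ (Fin n)) + e‖⁻¹ •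
    ((w : EuclideanSpace ℝ (Fin n)) + e)
  have hφ : LipschitzOnWith 2 φ (Metric.closedBall 0 3) := by
    have ht : LipschitzOnWith 1 (fun w : (ℝ ∙ e)ᗮ => (w : EuclideanSpace ℝ (Fin n)) + e)
        (Metric.closedBall 0 3) := by
      refine LipschitzOnWith.of_dist_le_mul fun a _ b _ => ?_
      simp [Subtype.dist_eq]
    have := lipschitzOnWith_normalize.comp ht (fun w _ => ?_)
    · rw [mul_one] at this
      exact this
    · have h1 := real_inner_le_norm e ((w : EuclideanSpace ℝ (Fin n)) + e)
      rw [inner_add_right, hinner, real_inner_self_eq_norm_sq, he] at h1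
      simpa using h1
  have hball : μHE[n - 1] (Metric.closedBall (0 : (ℝ ∙ e)ᗮ) 3) < ⊤ := by
    rw [← hfin]
    exact (isCompact_closedBall _ _).measure_lt_top
  refine ⟨φ '' Metric.closedBall 0 3, ?_, (euclideanHausdorffMeasure_image_le hφ _).trans_lt
    (ENNReal.mul_lt_top ENNReal.coe_lt_top hball)⟩
  have hU : {u : EuclideanSpace ℝ (Fin n) | 1 / 2 < ⟪e, u⟫} ∈ 𝓝 e := by
    refine (isOpen_lt continuous_const (by fun_prop)).mem_nhds ?_
    simp only [mem_ofPred_eq, real_inner_self_eq_norm_sq, he]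
    norm_num
  refine mem_of_superset (inter_mem_nhdsWithin _ hU) ?_
  rintro u ⟨hu, hpos⟩
  have hu : ‖u‖ = 1 := by simpa using hu
  have hpos : 1 / 2 < ⟪e, u⟫ := hpos
  have hpos' : 0 < ⟪e, u⟫ := by linarith
  let t := ⟪e, u⟫⁻¹
  have ht : 0 < t := inv_pos.2 hpos'
  have ht2 : t ≤ 2 := (inv_le_comm₀ hpos' two_pos).2 (by linarith)
  have hw : t • u - e ∈ (ℝ ∙ e)ᗮ := by
    rw [Submodule.mem_orthogonal_singleton_iff_inner_right, inner_sub_right, inner_smul_right,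
      real_inner_self_eq_norm_sq, he]
    simp [t, hpos'.ne']
  refine ⟨⟨t • u - e, hw⟩, ?_, ?_⟩
  · rw [mem_closedBall_zero_iff]
    refine (norm_sub_le (t • u) e).trans ?_
    rw [norm_smul, hu, he, Real.norm_of_nonneg ht.le]
    linarith
  · simp only [φ, sub_add_cancel, norm_smul, hu, mul_one, Real.norm_eq_abs, abs_of_pos ht,
      smul_smul, inv_mul_cancel₀ ht.ne', one_smul]

/-- The part of the argument that replaces an area formula: up to the factor `c ^ (n - 1)`, surface
measure of `K` is dominated by the image of surface measure of any `L` whose dilate by `c`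
contains `K`. -/
theorem restrict_frontier_le_map {K L : ConvexBody (EuclideanSpace ℝ (Fin n))}
    (hK : (interior (K : Set (EuclideanSpace ℝ (Fin n)))).Nonempty)
    {c : NNReal} (hc : 0 < c) (z : EuclideanSpace ℝ (Fin n))
    (h : ∀ y ∈ K, ∃ x ∈ L, y = z + (c : ℝ) • (x - z)) :
    (μHE[n - 1]).restrict (frontier (K : Set (EuclideanSpace ℝ (Fin n)))) ≤
      c ^ (n - 1) • ((μHE[n - 1]).restrict (frontier (L : Set (EuclideanSpace ℝ (Fin n))))).map
        (fun x => metricProj K (z + (c : ℝ) • (x - z))) := by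
  have hT : LipschitzWith c fun x => metricProj K (z + (c : ℝ) • (x - z)) := by
    refine LipschitzWith.of_dist_le_mul fun a b => ?_
    refine ((lipschitzWith_metricProj K).dist_le_mul _ _).trans (le_of_eq ?_)
    rw [dist_add_left, dist_smul₀, dist_sub_right]
    simp
  refine Measure.le_iff.2 fun A hA => ?_
  rw [Measure.restrict_apply hA, Measure.smul_apply, Measure.map_apply hT.continuous.measurable hA,
    Measure.restrict_apply (hT.continuous.measurable hA), ENNReal.smul_def, smul_eq_mul]
  refine (measure_mono ?_).trans (euclideanHausdorffMeasure_image_le hT.lipschitzOnWith _)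
  rintro y ⟨hyA, hy⟩
  obtain ⟨x, hx, rfl⟩ := frontier_subset_image_metricProj hK (NNReal.coe_pos.2 hc) z h hy
  exact ⟨x, ⟨hyA, hx⟩, rfl⟩

/-- The closed unit ball as a convex body. -/
def unitBallBody (n : ℕ) : ConvexBody (EuclideanSpace ℝ (Fin n)) where
  carrier := Metric.closedBall 0 1
  convex' := convex_closedBall _ _
  isCompact' := isCompact_closedBall _ _
  nonempty' := ⟨0, by simp⟩

theorem measure_frontier_lt_top {K : ConvexBody (EuclideanSpace ℝ (Fin n))}
    (hK : (interior (K : Set (EuclideanSpace ℝ (Fin n)))).Nonempty) :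
    μHE[n - 1] (frontier (K : Set (EuclideanSpace ℝ (Fin n)))) < ⊤ := by
  obtain ⟨R, hR0, hR⟩ := K.isBounded.exists_pos_norm_le
  lift R to NNReal using hR0.le
  have hle := restrict_frontier_le_map (L := unitBallBody n) hK (c := R) (NNReal.coe_pos.1 hR0) 0
    fun y hy => ⟨(R : ℝ)⁻¹ • y, by
      change _ ∈ Metric.closedBall _ _
      rw [mem_closedBall_zero_iff, norm_smul, norm_inv, Real.norm_of_nonneg hR0.le,
        inv_mul_le_one₀ hR0]
      exact hR y hy, by
        rw [sub_zero, zero_add, smul_smul, mul_inv_cancel₀ hR0.ne', one_smul]⟩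
  have h1 := hle univ
  have hfr : frontier (unitBallBody n : Set (EuclideanSpace ℝ (Fin n))) ⊆ Metric.sphere 0 1 := by
    change frontier (Metric.closedBall _ _) ⊆ _
    exact Metric.frontier_closedBall_subset_sphere
  have hmeas : Measurable fun x : EuclideanSpace ℝ (Fin n) =>
      metricProj K (0 + (R : ℝ) • (x - 0)) :=
    ((lipschitzWith_metricProj K).continuous.comp (by fun_prop)).measurable
  rw [Measure.restrict_apply_univ, Measure.smul_apply, Measure.map_apply hmeas MeasurableSet.univ,
    preimage_univ, Measure.restrict_apply_univ, ENNReal.smul_def, smul_eq_mul] at h1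
  exact h1.trans_lt (ENNReal.mul_lt_top ENNReal.coe_lt_top
    ((measure_mono hfr).trans_lt measure_sphere_lt_top))

/-! ### Measurability of the Gauss map -/

theorem isClosed_normalBundle (K : ConvexBody (EuclideanSpace ℝ (Fin n))) :
    IsClosed {q : EuclideanSpace ℝ (Fin n) × EuclideanSpace ℝ (Fin n) |
      IsOuterUnitNormal K q.1 q.2} := by
  refine isClosed_iff_ultrafilter.2 fun q U hU hmem => ?_
  have h : Tendsto id (U : Filter _) (𝓝 q) := hU
  exact isOuterUnitNormal_of_tendsto (L := fun _ => K) (y := Prod.fst) (v := Prod.snd)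
    tendsto_const_nhds ((continuous_fst.tendsto q).comp h) ((continuous_snd.tendsto q).comp h) hmem

theorem isCompact_normalBundle (K : ConvexBody (EuclideanSpace ℝ (Fin n))) :
    IsCompact {q : EuclideanSpace ℝ (Fin n) × EuclideanSpace ℝ (Fin n) |
      IsOuterUnitNormal K q.1 q.2} :=
  (K.isCompact.prod (isCompact_sphere (0 : EuclideanSpace ℝ (Fin n)) 1)).of_isClosed_subset
    (isClosed_normalBundle K) fun _ hq => ⟨mem_of_mem_frontier K hq.1, by simpa using hq.2.1⟩

/-- The points over which a compact relation is multivalued form an `Fσ` set. -/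
theorem measurableSet_multivalued {X Y : Type*} [MetricSpace X] [MeasurableSpace X] [BorelSpace X]
    [MetricSpace Y] {S : Set (X × Y)} (hS : IsCompact S) :
    MeasurableSet {x | ∃ y z, y ≠ z ∧ (x, y) ∈ S ∧ (x, z) ∈ S} := by
  have hcl : ∀ k : ℕ, IsClosed {x | ∃ y z, 1 / ((k : ℝ) + 1) ≤ dist y z ∧ (x, y) ∈ S ∧
      (x, z) ∈ S} := by
    intro k
    have hc : IsClosed {q : (X × Y) × (X × Y) | q.1.1 = q.2.1 ∧
        1 / ((k : ℝ) + 1) ≤ dist q.1.2 q.2.2} :=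
      (isClosed_eq (continuous_fst.comp continuous_fst) (continuous_fst.comp continuous_snd)).inter
        (isClosed_le continuous_const ((continuous_snd.comp continuous_fst).dist
          (continuous_snd.comp continuous_snd)))
    have := (((hS.prod hS).inter_right hc).image
      (continuous_fst.comp continuous_fst : Continuous fun q : (X × Y) × (X × Y) => q.1.1)).isClosed
    refine Eq.mpr (congrArg IsClosed (Set.ext fun x => ?_)) this
    constructor
    · rintro ⟨y, z, hd, hy, hz⟩
      exact ⟨((x, y), (x, z)), ⟨⟨hy, hz⟩, rfl, hd⟩, rfl⟩
    · rintro ⟨⟨⟨x1, y⟩, ⟨x2, z⟩⟩, ⟨⟨hy, hz⟩, hx, hd⟩, rfl⟩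
      obtain rfl : x1 = x2 := hx
      exact ⟨y, z, hd, hy, hz⟩
  refine Eq.mpr (congrArg MeasurableSet (Set.ext fun x => ?_))
    (MeasurableSet.iUnion fun k => (hcl k).measurableSet)
  simp only [mem_ofPred_eq, mem_iUnion]
  constructor
  · rintro ⟨y, z, hyz, h⟩
    obtain ⟨k, hk⟩ := exists_nat_one_div_lt (dist_pos.2 hyz)
    exact ⟨k, y, z, hk.le, h⟩
  · rintro ⟨k, y, z, hd, h⟩
    exact ⟨y, z, dist_pos.1 (lt_of_lt_of_le (by positivity) hd), h⟩

/-- The boundary points with two different outer unit normals. -/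
def irregularPoints (K : ConvexBody (EuclideanSpace ℝ (Fin n))) :
    Set (EuclideanSpace ℝ (Fin n)) :=
  {x | ∃ u v, u ≠ v ∧ IsOuterUnitNormal K x u ∧ IsOuterUnitNormal K x v}

theorem measurableSet_irregularPoints (K : ConvexBody (EuclideanSpace ℝ (Fin n))) :
    MeasurableSet (irregularPoints K) :=
  measurableSet_multivalued (isCompact_normalBundle K)

theorem measurableSet_irregularNormals (K : ConvexBody (EuclideanSpace ℝ (Fin n))) :
    MeasurableSet (irregularNormals K) := by
  refine Eq.mpr (congrArg MeasurableSet (Set.ext fun x => ?_))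
    (measurableSet_multivalued ((isCompact_normalBundle K).image continuous_swap))
  simp [irregularNormals]

theorem isOuterUnitNormal_gaussMap {K : ConvexBody (EuclideanSpace ℝ (Fin n))}
    {x : EuclideanSpace ℝ (Fin n)} (h : ∃! u, IsOuterUnitNormal K x u) :
    IsOuterUnitNormal K x (gaussMap K x) := by
  rw [gaussMap, dif_pos h]
  exact h.choose_spec.1

theorem gaussMap_eq_zero {K : ConvexBody (EuclideanSpace ℝ (Fin n))}
    {x : EuclideanSpace ℝ (Fin n)} (h : ¬ ∃! u, IsOuterUnitNormal K x u) : gaussMap K x = 0 := by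
  rw [gaussMap, dif_neg h]

theorem measurable_gaussMap (K : ConvexBody (EuclideanSpace ℝ (Fin n))) :
    Measurable (gaussMap K) := by
  let S := {x | ∃! u, IsOuterUnitNormal K x u}
  have hS : MeasurableSet S := by
    have h1 := ((isCompact_normalBundle K).image continuous_fst).isClosed.measurableSet
    refine Eq.mpr (congrArg MeasurableSet (Set.ext fun x => ?_))
      (h1.diff (measurableSet_irregularPoints K))
    constructor
    · rintro ⟨u, hu, huniq⟩
      exact ⟨⟨(x, u), hu, rfl⟩, fun ⟨v, w, hvw, hv, hw⟩ => hvw ((huniq v hv).trans (huniq w hw).symm)⟩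
    · rintro ⟨⟨⟨x, u⟩, hu, rfl⟩, hx⟩
      exact ⟨u, hu, fun v hv => by_contra fun hvu => hx ⟨v, u, hvu, hv, hu⟩⟩
  have hcont : ContinuousOn (gaussMap K) S := fun x hx =>
    tendsto_normal (L := fun _ => K) (y := id) tendsto_const_nhds nhdsWithin_le_nhds
      (eventually_of_mem self_mem_nhdsWithin fun y hy => isOuterUnitNormal_gaussMap hy)
      fun w hw => hx.unique hw (isOuterUnitNormal_gaussMap hx)
  refine measurable_of_restrict_of_restrict_compl hS
    (continuousOn_iff_continuous_domRestrict.1 hcont).measurable ?_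
  have : Sᶜ.domRestrict (gaussMap K) = fun _ => 0 := funext fun x => gaussMap_eq_zero x.2
  rw [this]
  exact measurable_const

/-! ### Irregular boundary points are negligible -/

/-- The polar body `K° = {y | ⟪x, y⟫ ≤ 1 for all x ∈ K}`. -/
def polarBody (K : ConvexBody (EuclideanSpace ℝ (Fin n)))
    (hK : (0 : EuclideanSpace ℝ (Fin n)) ∈ interior (K : Set (EuclideanSpace ℝ (Fin n)))) :
    ConvexBody (EuclideanSpace ℝ (Fin n)) where
  carrier := {y | ∀ x ∈ K, ⟪x, y⟫ ≤ 1}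
  convex' := by
    intro y hy z hz a b ha hb hab x hx
    rw [inner_add_right, inner_smul_right, inner_smul_right]
    nlinarith [hy x hx, hz x hx]
  isCompact' := by
    obtain ⟨r, hr, hball⟩ := Metric.nhds_basis_closedBall.mem_iff.1 (mem_interior_iff_mem_nhds.1 hK)
    refine (isCompact_closedBall (0 : EuclideanSpace ℝ (Fin n)) r⁻¹).of_isClosed_subset ?_ ?_
    · simp only [ofPred_forall]
      exact isClosed_biInter fun x _ => isClosed_le (by fun_prop) continuous_const
    · intro y hy
      rw [mem_closedBall_zero_iff]
      rcases (norm_nonneg y).eq_or_lt' with h0 | h0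
      · rw [h0]; positivity
      have h1 := hy ((r / ‖y‖) • y) (hball (by
        rw [mem_closedBall_zero_iff, norm_smul, Real.norm_of_nonneg (by positivity),
          div_mul_cancel₀ _ h0.ne']))
      rw [real_inner_smul_left, real_inner_self_eq_norm_sq] at h1
      have h2 : r / ‖y‖ * ‖y‖ ^ 2 = r * ‖y‖ := by field_simp
      rw [← one_div, le_div_iff₀ hr]
      linarith
  nonempty' := ⟨0, by simp⟩

/-- Two normals `u ≠ v` at `x ∈ ∂K` yield two boundary points `u / h(u) ≠ v / h(v)` of the polar
body with the same normal `x / ‖x‖`. Hence the radial projection of the irregular points of `K`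
lies in the null set of irregular normals of the polar body, and the inverse of the radial
projection is Lipschitz. -/
theorem measure_irregularPoints {K : ConvexBody (EuclideanSpace ℝ (Fin n))}
    (hK : (0 : EuclideanSpace ℝ (Fin n)) ∈ interior (K : Set (EuclideanSpace ℝ (Fin n)))) :
    μHE[n - 1] (irregularPoints K) = 0 := by
  set P := polarBody K hK with hP
  have hPmem : ∀ y, y ∈ P ↔ ∀ x ∈ K, ⟪x, y⟫ ≤ 1 := fun y => Iff.rfl
  obtain ⟨R, hR0, hR⟩ := K.isBounded.exists_pos_norm_le
  have hlow : ∀ ω : EuclideanSpace ℝ (Fin n), ‖ω‖ = 1 → R⁻¹ ≤ supportFunction P ω := by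
    intro ω hω
    have hmem : R⁻¹ • ω ∈ P := by
      rw [hPmem]
      intro x hx
      refine (real_inner_le_norm _ _).trans ?_
      rw [norm_smul, hω, mul_one, norm_inv, Real.norm_of_nonneg hR0.le, ← div_eq_mul_inv,
        div_le_one hR0]
      exact hR x hx
    have := inner_le_supportFunction P ω hmem
    rwa [real_inner_smul_left, real_inner_self_eq_norm_sq, hω, one_pow, mul_one] at this
  obtain ⟨C, hC⟩ := exists_lipschitzWith_supportFunction P
  let ψ : EuclideanSpace ℝ (Fin n) → EuclideanSpace ℝ (Fin n) := fun ω =>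
    (supportFunction P ω)⁻¹ • ω
  have hψ : LipschitzOnWith (R.toNNReal + R.toNNReal * R.toNNReal * C) ψ
      (irregularNormals P) := by
    refine LipschitzOnWith.of_dist_le_mul fun ω hω ω' hω' => ?_
    have h1 : ‖ω‖ = 1 := by obtain ⟨_, _, -, h, -⟩ := hω; exact h.2.1
    have h1' : ‖ω'‖ = 1 := by obtain ⟨_, _, -, h, -⟩ := hω'; exact h.2.1
    have ha := hlow ω h1
    have hb := hlow ω' h1'
    have hR1 : 0 < R⁻¹ := inv_pos.2 hR0
    have hd := hC.dist_le_mul ω ω'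
    set a := supportFunction P ω
    set b := supportFunction P ω'
    have ha0 : 0 < a := hR1.trans_le ha
    have hb0 : 0 < b := hR1.trans_le hb
    have ha1 : a⁻¹ ≤ R := inv_le_of_inv_le₀ hR0 ha
    have hb1 : b⁻¹ ≤ R := inv_le_of_inv_le₀ hR0 hb
    have e : ψ ω - ψ ω' = a⁻¹ • (ω - ω') + (a⁻¹ * b⁻¹ * (b - a)) • ω' := by
      have : a⁻¹ * b⁻¹ * (b - a) = a⁻¹ - b⁻¹ := by field_simp
      rw [this, smul_sub, sub_smul]
      simp only [ψ]
      abel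
    rw [dist_eq_norm, e]
    refine (norm_add_le _ _).trans ?_
    rw [norm_smul, norm_smul, h1', mul_one, norm_mul, Real.norm_of_nonneg (by positivity : 0 ≤ a⁻¹),
      Real.norm_of_nonneg (by positivity : 0 ≤ a⁻¹ * b⁻¹), ← dist_eq_norm, ← dist_eq_norm,
      dist_comm b a]
    push_cast
    rw [Real.coe_toNNReal _ hR0.le, add_mul, mul_assoc (R * R)]
    gcongr
  have hsub : irregularPoints K ⊆ ψ '' irregularNormals P := by
    rintro x ⟨u, v, huv, hu, hv⟩
    have hx0 : x ≠ 0 := by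
      rintro rfl
      exact hu.1.2 hK
    have hxn : 0 < ‖x‖ := norm_pos_iff.2 hx0
    have hpos : ∀ w, ‖w‖ = 1 → 0 < supportFunction K w := by
      intro w hw
      by_contra! hle
      have h0 : supportFunction K w = 0 := le_antisymm hle
        (by simpa using inner_le_supportFunction K w (interior_subset hK))
      have : IsOuterUnitNormal K 0 w :=
        isOuterUnitNormal_iff.2 ⟨interior_subset hK, hw, by simp [h0]⟩
      exact this.1.2 hK
    have hle : ∀ y ∈ P, ⟪y, ‖x‖⁻¹ • x⟫ ≤ ‖x‖⁻¹ := by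
      intro y hy
      rw [inner_smul_right, real_inner_comm]
      exact mul_le_of_le_one_right (by positivity) (hy x (mem_of_mem_frontier K hu.1))
    have hkey : ∀ w, IsOuterUnitNormal K x w → (supportFunction K w)⁻¹ • w ∈ P ∧
        ⟪(supportFunction K w)⁻¹ • w, ‖x‖⁻¹ • x⟫ = ‖x‖⁻¹ := by
      intro w hw
      have hw0 := hpos w hw.2.1
      constructor
      · rw [hPmem]
        intro y hy
        rw [inner_smul_right, inv_mul_le_one₀ hw0]
        exact inner_le_supportFunction K w hy
      · rw [inner_smul_right, real_inner_smul_left, real_inner_comm, hw.2.2,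
          inv_mul_cancel₀ hw0.ne', mul_one]
    have hsupp : supportFunction P (‖x‖⁻¹ • x) = ‖x‖⁻¹ := by
      obtain ⟨y, hy, hye, -⟩ := exists_eq_supportFunction P (‖x‖⁻¹ • x)
      refine le_antisymm (hye ▸ hle y hy) ?_
      refine (hkey u hu).2.symm.le.trans ?_
      exact inner_le_supportFunction P _ (hkey u hu).1
    have hnorm : ‖‖x‖⁻¹ • x‖ = 1 := by
      rw [norm_smul, norm_inv, norm_norm, inv_mul_cancel₀ hxn.ne']
    refine ⟨‖x‖⁻¹ • x, ⟨(supportFunction K u)⁻¹ • u, (supportFunction K v)⁻¹ • v, fun heq => ?_,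
      isOuterUnitNormal_iff.2 ⟨(hkey u hu).1, hnorm, (hkey u hu).2.trans hsupp.symm⟩,
      isOuterUnitNormal_iff.2 ⟨(hkey v hv).1, hnorm, (hkey v hv).2.trans hsupp.symm⟩⟩, ?_⟩
    · have hn := congrArg norm heq
      rw [norm_smul, norm_smul, hu.2.1, hv.2.1, mul_one, mul_one, norm_inv, norm_inv,
        Real.norm_of_nonneg (hpos u hu.2.1).le, Real.norm_of_nonneg (hpos v hv.2.1).le] at hn
      rw [hn] at heq
      exact huv (smul_right_injective _ (inv_pos.2 (hpos v hv.2.1)).ne' heq)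
    · simp only [ψ, hsupp, inv_inv, smul_smul, mul_inv_cancel₀ hxn.ne', one_smul]
  refine measure_mono_null hsub (le_antisymm
    ((euclideanHausdorffMeasure_image_le hψ _).trans ?_) zero_le)
  rw [measure_irregularNormals, mul_zero]

/-! ### Weak convergence of the zeroth curvature measure -/

/-- A point of `K` at which `⟪·, u⟫` attains its maximum. -/
noncomputable def supportPoint (K : ConvexBody (EuclideanSpace ℝ (Fin n)))
    (u : EuclideanSpace ℝ (Fin n)) : EuclideanSpace ℝ (Fin n) :=
  (exists_eq_supportFunction K u).choose

theorem isOuterUnitNormal_supportPoint (K : ConvexBody (EuclideanSpace ℝ (Fin n)))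
    {u : EuclideanSpace ℝ (Fin n)} (hu : ‖u‖ = 1) : IsOuterUnitNormal K (supportPoint K u) u :=
  isOuterUnitNormal_iff.2 ⟨(exists_eq_supportFunction K u).choose_spec.1, hu,
    (exists_eq_supportFunction K u).choose_spec.2.1⟩

/-- Off the irregular normals of the limit body, support points converge. -/
theorem tendsto_supportPoint_of_notMem {ι : Type*} {l : Filter ι}
    {L : ι → ConvexBody (EuclideanSpace ℝ (Fin n))} {K : ConvexBody (EuclideanSpace ℝ (Fin n))}
    {v : ι → EuclideanSpace ℝ (Fin n)} {u : EuclideanSpace ℝ (Fin n)}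
    (hL : Tendsto L l (𝓝 K)) (hv : Tendsto v l (𝓝 u)) (hv1 : ∀ᶠ i in l, ‖v i‖ = 1)
    (hu : ‖u‖ = 1) (hreg : u ∉ irregularNormals K) :
    Tendsto (fun i => supportPoint (L i) (v i)) l (𝓝 (supportPoint K u)) :=
  tendsto_supportPoint hL hv (hv1.mono fun i hi => isOuterUnitNormal_supportPoint (L i) hi)
    fun w hw => by_contra fun hne =>
      hreg ⟨w, _, hne, hw, isOuterUnitNormal_supportPoint K hu⟩

theorem aemeasurable_supportPoint (K : ConvexBody (EuclideanSpace ℝ (Fin n))) :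
    AEMeasurable (supportPoint K) ((μHE[n - 1]).restrict (Metric.sphere 0 1)) := by
  have hS : MeasurableSet (Metric.sphere (0 : EuclideanSpace ℝ (Fin n)) 1 \ irregularNormals K) :=
    Metric.isClosed_sphere.measurableSet.diff (measurableSet_irregularNormals K)
  have hc : ContinuousOn (supportPoint K) (Metric.sphere 0 1 \ irregularNormals K) := by
    intro u hu
    exact tendsto_supportPoint_of_notMem (L := fun _ => K) (v := id) tendsto_const_nhds
      nhdsWithin_le_nhds (eventually_of_mem self_mem_nhdsWithin fun v hv => by simpa using hv.1)
      (by simpa using hu.1) hu.2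
  have := hc.aemeasurable (μ := μHE[n - 1]) hS
  rwa [Measure.restrict_congr_set (sdiff_null_ae_eq_self (measure_irregularNormals K))] at this

/-- `C₀(K, ·)` is the image of surface measure on the sphere under the support point map. -/
theorem curvatureMeasureZero_eq_map (K : ConvexBody (EuclideanSpace ℝ (Fin n))) :
    curvatureMeasureZero K =
      ((μHE[n - 1]).restrict (Metric.sphere 0 1)).map (supportPoint K) := by
  ext β hβ
  rw [curvatureMeasureZero_apply K hβ, Measure.map_apply_of_aemeasurable
    (aemeasurable_supportPoint K) hβ, Measure.restrict_apply' Metric.isClosed_sphere.measurableSet]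
  apply le_antisymm
  · refine (measure_mono (t := supportPoint K ⁻¹' β ∩ Metric.sphere 0 1 ∪ irregularNormals K)
      ?_).trans ((measure_union_le _ _).trans (by rw [measure_irregularNormals, add_zero]))
    rintro u ⟨x, hx, hxu⟩
    by_cases hu : u ∈ irregularNormals K
    · exact Or.inr hu
    · have heq : x = supportPoint K u := by_contra fun hne =>
        hu ⟨x, _, hne, hxu, isOuterUnitNormal_supportPoint K hxu.2.1⟩
      exact Or.inl ⟨by rwa [heq] at hx, by simpa using hxu.2.1⟩
  · refine measure_mono fun u hu => ⟨_, hu.1, isOuterUnitNormal_supportPoint K ?_⟩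
    simpa using hu.2

theorem setIntegral_curvatureMeasureZero (K : ConvexBody (EuclideanSpace ℝ (Fin n)))
    {f : EuclideanSpace ℝ (Fin n) → ℝ} (hf : Continuous f) :
    ∫ x in frontier (K : Set (EuclideanSpace ℝ (Fin n))), f x ∂(curvatureMeasureZero K) =
      ∫ u in Metric.sphere 0 1, f (supportPoint K u) ∂μHE[n - 1] := by
  have hres : (curvatureMeasureZero K).restrict (frontier (K : Set (EuclideanSpace ℝ (Fin n)))) =
      curvatureMeasureZero K := by
    refine Measure.restrict_eq_self_of_ae_mem ?_
    rw [ae_iff, show {x | x ∉ frontier (K : Set (EuclideanSpace ℝ (Fin n)))} =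
      (frontier (K : Set (EuclideanSpace ℝ (Fin n))))ᶜ from rfl,
      curvatureMeasureZero_apply K isClosed_frontier.measurableSet.compl]
    have : sphericalImage K (frontier (K : Set (EuclideanSpace ℝ (Fin n))))ᶜ = ∅ :=
      eq_empty_of_forall_notMem fun u ⟨x, hx, hxu⟩ => hx hxu.1
    rw [this, measure_empty]
  rw [hres, curvatureMeasureZero_eq_map, integral_map (aemeasurable_supportPoint K)
    hf.aestronglyMeasurable]

instance isFiniteMeasure_restrict_sphere : IsFiniteMeasure
    ((μHE[n - 1]).restrict (Metric.sphere (0 : EuclideanSpace ℝ (Fin n)) 1)) :=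
  ⟨by rw [Measure.restrict_apply_univ]; exact measure_sphere_lt_top⟩

theorem exists_eventually_forall_norm_le {ι : Type*} {l : Filter ι}
    {L : ι → ConvexBody (EuclideanSpace ℝ (Fin n))} {K : ConvexBody (EuclideanSpace ℝ (Fin n))}
    (hL : Tendsto L l (𝓝 K)) {f : EuclideanSpace ℝ (Fin n) → ℝ} (hf : Continuous f) :
    ∃ M : ℝ, 0 ≤ M ∧ (∀ x ∈ K, ‖f x‖ ≤ M) ∧ ∀ᶠ i in l, ∀ x ∈ L i, ‖f x‖ ≤ M := by
  obtain ⟨R, hR⟩ := exists_eventually_norm_le hL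
  obtain ⟨R', hR'⟩ := K.isBounded.exists_norm_le
  obtain ⟨M, hM⟩ := (isCompact_closedBall (0 : EuclideanSpace ℝ (Fin n))
    (max R R')).exists_bound_of_continuousOn hf.continuousOn
  refine ⟨max M 0, le_max_right _ _, fun x hx => (hM x ?_).trans (le_max_left _ _),
    hR.mono fun i hi x hx => (hM x ?_).trans (le_max_left _ _)⟩
  · exact mem_closedBall_zero_iff.2 ((hR' x hx).trans (le_max_right _ _))
  · exact mem_closedBall_zero_iff.2 ((hi x hx).trans (le_max_left _ _))

theorem tendsto_setIntegral_curvatureMeasureZero {ι : Type*} {l : Filter ι}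
    [l.IsCountablyGenerated] {L : ι → ConvexBody (EuclideanSpace ℝ (Fin n))}
    {K : ConvexBody (EuclideanSpace ℝ (Fin n))} (hL : Tendsto L l (𝓝 K))
    {f : EuclideanSpace ℝ (Fin n) → ℝ} (hf : Continuous f) :
    Tendsto (fun i => ∫ x in frontier (L i : Set (EuclideanSpace ℝ (Fin n))), f x
      ∂(curvatureMeasureZero (L i))) l
      (𝓝 (∫ x in frontier (K : Set (EuclideanSpace ℝ (Fin n))), f x
        ∂(curvatureMeasureZero K))) := by
  simp only [setIntegral_curvatureMeasureZero _ hf]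
  obtain ⟨M, -, -, hM⟩ := exists_eventually_forall_norm_le hL hf
  have hmem : ∀ᵐ u ∂(μHE[n - 1]).restrict (Metric.sphere (0 : EuclideanSpace ℝ (Fin n)) 1),
      ‖u‖ = 1 :=
    (ae_restrict_mem Metric.isClosed_sphere.measurableSet).mono fun u hu => by simpa using hu
  have hreg : ∀ᵐ u ∂(μHE[n - 1]).restrict (Metric.sphere (0 : EuclideanSpace ℝ (Fin n)) 1),
      u ∉ irregularNormals K :=
    ae_restrict_of_ae (measure_eq_zero_iff_ae_notMem.1 (measure_irregularNormals K))
  refine tendsto_integral_filter_of_dominated_convergence (fun _ => M)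
    (Eventually.of_forall fun i =>
      (hf.measurable.comp_aemeasurable (aemeasurable_supportPoint (L i))).aestronglyMeasurable)
    (hM.mono fun i hi => hmem.mono fun u hu =>
      hi _ (mem_of_mem_frontier _ (isOuterUnitNormal_supportPoint (L i) hu).1))
    (integrable_const _) ?_
  filter_upwards [hmem, hreg] with u hu hu'
  exact (hf.tendsto _).comp (tendsto_supportPoint_of_notMem hL tendsto_const_nhds
    (Eventually.of_forall fun _ => hu) hu hu')

/-! ### Upper semicontinuity of surface integrals -/

/-- If the functions `G i` on `∂(L i)` are asymptotically bounded by `G₀` at almost every point of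
`∂K`, then so are their surface integrals. -/
theorem eventually_setIntegral_frontier_lt {ι : Type*} {l : Filter ι}
    [l.IsCountablyGenerated] {L : ι → ConvexBody (EuclideanSpace ℝ (Fin n))}
    {K : ConvexBody (EuclideanSpace ℝ (Fin n))} (hL : Tendsto L l (𝓝 K))
    (hK : (interior (K : Set (EuclideanSpace ℝ (Fin n)))).Nonempty)
    (hLint : ∀ᶠ i in l, (interior (L i : Set (EuclideanSpace ℝ (Fin n)))).Nonempty)
    {G : ι → EuclideanSpace ℝ (Fin n) → ℝ} {G₀ : EuclideanSpace ℝ (Fin n) → ℝ} {M : ℝ}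
    (hG : ∀ i, Measurable (G i)) (hG₀ : Measurable G₀)
    (hbound : ∀ᶠ i in l, ∀ x ∈ frontier (L i : Set (EuclideanSpace ℝ (Fin n))),
      0 ≤ G i x ∧ G i x ≤ M)
    (hbound₀ : ∀ x ∈ frontier (K : Set (EuclideanSpace ℝ (Fin n))), 0 ≤ G₀ x ∧ G₀ x ≤ M)
    (hlim : ∀ᵐ x ∂(μHE[n - 1]).restrict (frontier (K : Set (EuclideanSpace ℝ (Fin n)))),
      ∀ y : ι → EuclideanSpace ℝ (Fin n), Tendsto y l (𝓝 x) → ∀ a, G₀ x < a →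
        ∀ᶠ i in l, y i ∈ frontier (L i : Set (EuclideanSpace ℝ (Fin n))) → G i (y i) < a)
    {b : ℝ} (hb : ∫ x in frontier (K : Set (EuclideanSpace ℝ (Fin n))), G₀ x ∂μHE[n - 1] < b) :
    ∀ᶠ i in l, ∫ x in frontier (L i : Set (EuclideanSpace ℝ (Fin n))), G i x ∂μHE[n - 1] < b := by
  obtain ⟨z, hz⟩ := hK
  obtain ⟨r, hr, hball⟩ := Metric.nhds_basis_closedBall.mem_iff.1 (mem_interior_iff_mem_nhds.1 hz)
  have : IsFiniteMeasure
      ((μHE[n - 1]).restrict (frontier (K : Set (EuclideanSpace ℝ (Fin n))))) :=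
    ⟨by rw [Measure.restrict_apply_univ]; exact measure_frontier_lt_top ⟨z, hz⟩⟩
  let c : ι → NNReal := fun i => 1 + nndist (L i) K / r.toNNReal
  have hc : Tendsto (fun i => (c i : ℝ)) l (𝓝 1) := by
    simpa [c, hr.le] using ((tendsto_iff_dist_tendsto_zero.1 hL).div_const r).const_add 1
  have hc0 : ∀ i, 0 < c i := fun i => by positivity
  let T : ι → EuclideanSpace ℝ (Fin n) → EuclideanSpace ℝ (Fin n) := fun i x =>
    metricProj (L i) (z + (c i : ℝ) • (x - z))
  have hT : ∀ i, Measurable (T i) := fun i =>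
    ((lipschitzWith_metricProj (L i)).continuous.comp (by fun_prop)).measurable
  -- `T i` need not map all of `∂K` into `∂(L i)`, and nothing is known about `G i` off `∂(L i)`.
  let F : ι → EuclideanSpace ℝ (Fin n) → ℝ := fun i =>
    (frontier (L i : Set (EuclideanSpace ℝ (Fin n)))).indicator (G i)
  have hF : ∀ i, Measurable (F i) := fun i => (hG i).indicator isClosed_frontier.measurableSet
  have hmemK := ae_restrict_mem (μ := (μHE[n - 1] : Measure (EuclideanSpace ℝ (Fin n))))
    (isClosed_frontier (s := (K : Set (EuclideanSpace ℝ (Fin n))))).measurableSet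
  -- The assumptions bound `G i` only from above. The maximum with `G₀` converges, and it still
  -- dominates.
  have hlimit : Tendsto (fun i => ((c i ^ (n - 1) : NNReal) : ℝ) *
      ∫ x in frontier (K : Set (EuclideanSpace ℝ (Fin n))), max (F i (T i x)) (G₀ x) ∂μHE[n - 1]) l
      (𝓝 (∫ x in frontier (K : Set (EuclideanSpace ℝ (Fin n))), G₀ x ∂μHE[n - 1])) := by
    have h1 : Tendsto (fun i => ((c i ^ (n - 1) : NNReal) : ℝ)) l (𝓝 1) := by
      simpa using hc.pow (n - 1)
    have h2 : Tendsto (fun i => ∫ x in frontier (K : Set (EuclideanSpace ℝ (Fin n))),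
        max (F i (T i x)) (G₀ x) ∂μHE[n - 1]) l
        (𝓝 (∫ x in frontier (K : Set (EuclideanSpace ℝ (Fin n))), G₀ x ∂μHE[n - 1])) := by
      refine tendsto_integral_filter_of_dominated_convergence (fun _ => M)
        (Eventually.of_forall fun i =>
          (((hF i).comp (hT i)).max hG₀).aestronglyMeasurable)
        (hbound.mono fun i hi => hmemK.mono fun x hx => ?_) (integrable_const _) ?_
      · have h0 := hbound₀ x hx
        rw [Real.norm_of_nonneg (h0.1.trans (le_max_right _ _))]
        refine max_le ?_ h0.2
        by_cases hm : T i x ∈ frontier (L i : Set (EuclideanSpace ℝ (Fin n)))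
        · simp only [F, indicator_of_mem hm]
          exact (hi _ hm).2
        · simp only [F, indicator_of_notMem hm]
          exact h0.1.trans h0.2
      · filter_upwards [hmemK, hlim] with x hx hlx
        have hTx : Tendsto (fun i => T i x) l (𝓝 x) :=
          tendsto_metricProj_dilate hL z hc (mem_of_mem_frontier K hx)
        refine tendsto_order.2 ⟨fun a ha => Eventually.of_forall fun i =>
          lt_of_lt_of_le ha (le_max_right _ _), fun a ha => ?_⟩
        refine (hlx _ hTx a ha).mono fun i hi => max_lt ?_ ha
        by_cases hm : T i x ∈ frontier (L i : Set (EuclideanSpace ℝ (Fin n)))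
        · simp only [F, indicator_of_mem hm]
          exact hi hm
        · simp only [F, indicator_of_notMem hm]
          exact (hbound₀ x hx).1.trans_lt ha
    simpa using h1.mul h2
  filter_upwards [hlimit.eventually_lt_const hb, hLint, hbound] with i hi hint hbd
  refine lt_of_le_of_lt ?_ hi
  have hF0 : ∀ y, 0 ≤ F i y := fun y => indicator_nonneg (fun y hy => (hbd y hy).1) y
  have hM0 : 0 ≤ |M| := abs_nonneg M
  have hFM : ∀ y, F i y ≤ |M| := fun y =>
    indicator_le' (fun y hy => (hbd y hy).2.trans (le_abs_self M)) (fun _ _ => hM0) y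
  have hmono := restrict_frontier_le_map (L := K) hint (hc0 i) z fun y hy => by
    simpa [c, hr.le] using exists_eq_add_smul_of_mem hr hball hy
  have hFT : Integrable (fun x => F i (T i x))
      ((μHE[n - 1]).restrict (frontier (K : Set (EuclideanSpace ℝ (Fin n))))) :=
    Integrable.of_bound ((hF i).comp (hT i)).aestronglyMeasurable |M|
      (Eventually.of_forall fun x => by rw [Real.norm_of_nonneg (hF0 _)]; exact hFM _)
  have hG₀i : Integrable G₀
      ((μHE[n - 1]).restrict (frontier (K : Set (EuclideanSpace ℝ (Fin n))))) :=
    Integrable.of_bound hG₀.aestronglyMeasurable M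
      (hmemK.mono fun x hx => by rw [Real.norm_of_nonneg (hbound₀ x hx).1]; exact (hbound₀ x hx).2)
  calc ∫ x in frontier (L i : Set (EuclideanSpace ℝ (Fin n))), G i x ∂μHE[n - 1]
      = ∫ x in frontier (L i : Set (EuclideanSpace ℝ (Fin n))), F i x ∂μHE[n - 1] :=
        setIntegral_congr_fun isClosed_frontier.measurableSet fun x hx =>
          (indicator_of_mem hx _).symm
    _ ≤ ∫ y, F i y ∂(c i ^ (n - 1) • ((μHE[n - 1]).restrict
          (frontier (K : Set (EuclideanSpace ℝ (Fin n))))).map (T i)) :=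
        integral_mono_measure hmono (Eventually.of_forall hF0)
          (((integrable_map_measure (hF i).aestronglyMeasurable (hT i).aemeasurable).2
            hFT).smul_measure_nnreal)
    _ = ((c i ^ (n - 1) : NNReal) : ℝ) *
          ∫ x in frontier (K : Set (EuclideanSpace ℝ (Fin n))), F i (T i x) ∂μHE[n - 1] := by
        rw [integral_smul_nnreal_measure, integral_map (hT i).aemeasurable
          (hF i).aestronglyMeasurable, NNReal.smul_def, smul_eq_mul]
    _ ≤ _ := by
        refine mul_le_mul_of_nonneg_left (integral_mono hFT (hFT.sup hG₀i) fun x => ?_)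
          (NNReal.coe_nonneg _)
        exact le_max_left _ _

/-! ### Infima of products of powers -/

/-- By Tietze's theorem an infimum over positive continuous functions on the varying boundaries
`∂K` is controlled by test functions that are continuous and positive on the whole space, so it is
upper semicontinuous if both factors are so for each such test function. -/
theorem upperSemicontinuousOn_iInf_mul_rpow {s : Set (ConvexBody (EuclideanSpace ℝ (Fin n)))}
    {A B : ConvexBody (EuclideanSpace ℝ (Fin n)) → (EuclideanSpace ℝ (Fin n) → ℝ) → ℝ} {α β : ℝ}
    (hα : 0 < α) (hβ : 0 < β)
    (hA₀ : ∀ K ∈ s, ∀ g, IsPositiveContinuous K g → 0 ≤ A K g)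
    (hB₀ : ∀ K ∈ s, ∀ g, IsPositiveContinuous K g → 0 ≤ B K g)
    (hAc : ∀ (K : ConvexBody (EuclideanSpace ℝ (Fin n))) (g g' : EuclideanSpace ℝ (Fin n) → ℝ),
      EqOn g g' (frontier (K : Set (EuclideanSpace ℝ (Fin n)))) → A K g = A K g')
    (hBc : ∀ (K : ConvexBody (EuclideanSpace ℝ (Fin n))) (g g' : EuclideanSpace ℝ (Fin n) → ℝ),
      EqOn g g' (frontier (K : Set (EuclideanSpace ℝ (Fin n)))) → B K g = B K g')
    (hA : ∀ K ∈ s, ∀ g, Continuous g → (∀ x, 0 < g x) → ∀ a, A K g < a →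
      ∀ᶠ L in 𝓝[s] K, A L g < a)
    (hB : ∀ K ∈ s, ∀ g, Continuous g → (∀ x, 0 < g x) → ∀ b, B K g < b →
      ∀ᶠ L in 𝓝[s] K, B L g < b) :
    UpperSemicontinuousOn (fun K : ConvexBody (EuclideanSpace ℝ (Fin n)) =>
      ⨅ g : {g : EuclideanSpace ℝ (Fin n) → ℝ // IsPositiveContinuous K g},
        A K g.1 ^ α * B K g.1 ^ β) s := by
  intro K hK y hy
  have : Nonempty {g : EuclideanSpace ℝ (Fin n) → ℝ // IsPositiveContinuous K g} :=
    ⟨⟨fun _ => 1, continuousOn_const, fun _ _ => one_pos⟩⟩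
  obtain ⟨⟨g₀, hg₀c, hg₀⟩, hlt⟩ := exists_lt_of_ciInf_lt hy
  obtain ⟨g, hg0, hg⟩ := ContinuousMap.exists_restrict_eq_forall_mem_of_closed (t := Ioi (0 : ℝ))
    ⟨_, hg₀c.domRestrict⟩ (fun x => hg₀ x.1 x.2) ⟨1, mem_Ioi.2 one_pos⟩
    (isClosed_frontier (s := (K : Set (EuclideanSpace ℝ (Fin n)))))
  have heq : EqOn g₀ g (frontier (K : Set (EuclideanSpace ℝ (Fin n)))) := fun x hx =>
    (DFunLike.congr_fun hg ⟨x, hx⟩).symm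
  simp only [hAc K g₀ g heq, hBc K g₀ g heq] at hlt
  have hpos : ∀ L : ConvexBody (EuclideanSpace ℝ (Fin n)), IsPositiveContinuous L g := fun L =>
    ⟨g.continuous.continuousOn, fun x _ => hg0 x⟩
  -- Enlarging both factors a little keeps the product below `y`.
  have hcont : ContinuousAt (fun t : ℝ => (A K g + t) ^ α * (B K g + t) ^ β) 0 :=
    ((continuous_const.add continuous_id).continuousAt.rpow_const (Or.inr hα.le)).mul
      ((continuous_const.add continuous_id).continuousAt.rpow_const (Or.inr hβ.le))
  obtain ⟨ε, hε, hball⟩ := Metric.eventually_nhds_iff.1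
    (hcont.eventually_lt_const (show _ < y by simpa using hlt))
  have hε2 := hball (y := ε / 2)
    (by rw [Real.dist_eq, sub_zero, abs_of_pos (by positivity)]; linarith)
  filter_upwards [hA K hK g g.continuous hg0 (A K g + ε / 2) (by linarith),
    hB K hK g g.continuous hg0 (B K g + ε / 2) (by linarith), self_mem_nhdsWithin] with L h1 h2 hL
  refine lt_of_le_of_lt ((ciInf_le ⟨0, ?_⟩ ⟨g, hpos L⟩).trans ?_) hε2
  · rintro _ ⟨f, rfl⟩
    exact mul_nonneg (Real.rpow_nonneg (hA₀ L hL _ f.2) _) (Real.rpow_nonneg (hB₀ L hL _ f.2) _)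
  · have hA1 := hA₀ L hL _ (hpos L)
    have hB1 := hB₀ L hL _ (hpos L)
    exact mul_le_mul (Real.rpow_le_rpow hA1 h1.le hα.le) (Real.rpow_le_rpow hB1 h2.le hβ.le)
      (Real.rpow_nonneg hB1 _) (Real.rpow_nonneg (hA1.trans h1.le) _)

/-! ### The two integrals in the affine surface area -/

theorem setIntegral_curvatureMeasureTop (K : ConvexBody (EuclideanSpace ℝ (Fin n)))
    (f : EuclideanSpace ℝ (Fin n) → ℝ) :
    ∫ x in frontier (K : Set (EuclideanSpace ℝ (Fin n))), f x ∂(curvatureMeasureTop K) =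
      ∫ x in frontier (K : Set (EuclideanSpace ℝ (Fin n))), f x ∂μHE[n - 1] := by
  rw [curvatureMeasureTop, Measure.restrict_restrict isClosed_frontier.measurableSet, inter_self]

theorem setIntegral_congr_frontier (K : ConvexBody (EuclideanSpace ℝ (Fin n)))
    (μ : Measure (EuclideanSpace ℝ (Fin n))) {g g' : EuclideanSpace ℝ (Fin n) → ℝ}
    (h : EqOn g g' (frontier (K : Set (EuclideanSpace ℝ (Fin n)))))
    (F : EuclideanSpace ℝ (Fin n) → ℝ → ℝ) :
    ∫ x in frontier (K : Set (EuclideanSpace ℝ (Fin n))), F x (g x) ∂μ =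
      ∫ x in frontier (K : Set (EuclideanSpace ℝ (Fin n))), F x (g' x) ∂μ :=
  setIntegral_congr_fun isClosed_frontier.measurableSet fun x hx => by simp only [h hx]

theorem eventually_setIntegral_zero_lt {s : Set (ConvexBody (EuclideanSpace ℝ (Fin n)))}
    {K : ConvexBody (EuclideanSpace ℝ (Fin n))} {g : EuclideanSpace ℝ (Fin n) → ℝ}
    (hg : Continuous g) (hg0 : ∀ x, 0 < g x) {a : ℝ}
    (ha : ∫ x in frontier (K : Set (EuclideanSpace ℝ (Fin n))), g x ^ (-(n : ℝ))
      ∂(curvatureMeasureZero K) < a) :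
    ∀ᶠ L : ConvexBody (EuclideanSpace ℝ (Fin n)) in 𝓝[s] K,
      ∫ x in frontier (L : Set (EuclideanSpace ℝ (Fin n))), g x ^ (-(n : ℝ))
        ∂(curvatureMeasureZero L) < a :=
  (tendsto_setIntegral_curvatureMeasureZero (L := id) (l := 𝓝[s] K) (K := K)
    (tendsto_id.mono_left nhdsWithin_le_nhds)
    (hg.rpow_const fun x => Or.inl (hg0 x).ne')).eventually_lt_const ha

theorem eventually_setIntegral_top_lt
    {K : ConvexBody (EuclideanSpace ℝ (Fin n))}
    (hK : (interior (K : Set (EuclideanSpace ℝ (Fin n)))).Nonempty)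
    {g : EuclideanSpace ℝ (Fin n) → ℝ} (hg : Continuous g) (hg0 : ∀ x, 0 < g x) {b : ℝ}
    (hb : ∫ x in frontier (K : Set (EuclideanSpace ℝ (Fin n))), g x ∂μHE[n - 1] < b) :
    ∀ᶠ L : ConvexBody (EuclideanSpace ℝ (Fin n)) in
      𝓝[{L : ConvexBody (EuclideanSpace ℝ (Fin n)) |
        (interior (L : Set (EuclideanSpace ℝ (Fin n)))).Nonempty}] K,
      ∫ x in frontier (L : Set (EuclideanSpace ℝ (Fin n))), g x ∂μHE[n - 1] < b := by
  have hL : Tendsto id (𝓝[{L : ConvexBody (EuclideanSpace ℝ (Fin n)) |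
      (interior (L : Set (EuclideanSpace ℝ (Fin n)))).Nonempty}] K) (𝓝 K) := nhdsWithin_le_nhds
  obtain ⟨M, -, hM, hM'⟩ := exists_eventually_forall_norm_le hL hg
  refine eventually_setIntegral_frontier_lt (G := fun _ => g) (M := M) hL hK self_mem_nhdsWithin
    (fun _ => hg.measurable) hg.measurable
    (hM'.mono fun L hL x hx => ⟨(hg0 x).le, (le_abs_self _).trans (hL x (mem_of_mem_frontier L hx))⟩)
    (fun x hx => ⟨(hg0 x).le, (le_abs_self _).trans (hM x (mem_of_mem_frontier K hx))⟩)
    (Eventually.of_forall fun x y hy a ha => ?_) hb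
  exact (((hg.tendsto x).comp hy).eventually_lt_const ha).mono fun i hi _ => hi

/-- At an irregular point the Gauss map has the junk value `0`. Since `h_K(0) = 0`, the weight there
is `0 ^ q`, which is never larger than the power of a positive number. -/
theorem supportFunction_gaussMap_rpow_le {K : ConvexBody (EuclideanSpace ℝ (Fin n))}
    {x : EuclideanSpace ℝ (Fin n)} (q : ℝ) {t : ℝ} (ht : 0 < t)
    (h : (∃! u, IsOuterUnitNormal K x u) → supportFunction K (gaussMap K x) ^ q ≤ t ^ q) :
    supportFunction K (gaussMap K x) ^ q ≤ t ^ q := by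
  by_cases hu : ∃! u, IsOuterUnitNormal K x u
  · exact h hu
  · obtain ⟨y, -, hy, -⟩ := exists_eq_supportFunction K (0 : EuclideanSpace ℝ (Fin n))
    rw [gaussMap_eq_zero hu, ← hy, inner_zero_right]
    rcases eq_or_ne q 0 with rfl | hq
    · simp
    · rw [Real.zero_rpow hq]
      positivity

theorem supportFunction_nonneg {K : ConvexBody (EuclideanSpace ℝ (Fin n))}
    (hK : (0 : EuclideanSpace ℝ (Fin n)) ∈ K) (u : EuclideanSpace ℝ (Fin n)) :
    0 ≤ supportFunction K u := by
  simpa using inner_le_supportFunction K u hK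

/-- Bodies near a body with the origin in its interior have support functions bounded away from
`0` and `∞` on the sphere, uniformly. -/
theorem exists_eventually_supportFunction_mem_Icc {K : ConvexBody (EuclideanSpace ℝ (Fin n))}
    (hK : (0 : EuclideanSpace ℝ (Fin n)) ∈ interior (K : Set (EuclideanSpace ℝ (Fin n)))) :
    ∃ r R : ℝ, 0 < r ∧ r ≤ R ∧ ∀ᶠ L in 𝓝 K, ∀ u : EuclideanSpace ℝ (Fin n), ‖u‖ = 1 →
      supportFunction L u ∈ Icc r R := by
  obtain ⟨r, hr, hball⟩ := Metric.nhds_basis_closedBall.mem_iff.1 (mem_interior_iff_mem_nhds.1 hK)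
  obtain ⟨R, hR⟩ := exists_eventually_norm_le (tendsto_id (x := 𝓝 K))
  refine ⟨r / 2, max (r / 2) R, by positivity, le_max_left _ _, ?_⟩
  filter_upwards [hR, Metric.ball_mem_nhds K (half_pos hr)] with L hL hd u hu
  have hd : dist L K < r / 2 := hd
  constructor
  · have h1 := supportFunction_le_add K L u
    have h2 := inner_le_supportFunction K u (y := r • u) (hball (by
      rw [mem_closedBall_zero_iff, norm_smul, hu, Real.norm_of_nonneg hr.le, mul_one]))
    rw [real_inner_smul_left, real_inner_self_eq_norm_sq, hu] at h2
    rw [hu, dist_comm] at h1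
    linarith
  · obtain ⟨x, hx, hxe, -⟩ := exists_eq_supportFunction L u
    rw [← hxe]
    refine (real_inner_le_norm _ _).trans ?_
    rw [hu, mul_one]
    exact (hL x hx).trans (le_max_right _ _)

theorem rpow_le_add_of_mem_Icc {r R t : ℝ} (hr : 0 < r) (h : t ∈ Icc r R) (q : ℝ) :
    t ^ q ≤ r ^ q + R ^ q := by
  have ht : 0 < t := hr.trans_le h.1
  have hR : 0 < R := ht.trans_le h.2
  rcases le_total 0 q with hq | hq
  · exact (Real.rpow_le_rpow ht.le h.2 hq).trans (le_add_of_nonneg_left (by positivity))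
  · exact (Real.rpow_le_rpow_of_nonpos hr h.1 hq).trans (le_add_of_nonneg_right (by positivity))

theorem eventually_setIntegral_top_weighted_lt
    {K : ConvexBody (EuclideanSpace ℝ (Fin n))}
    (hK : (0 : EuclideanSpace ℝ (Fin n)) ∈ interior (K : Set (EuclideanSpace ℝ (Fin n)))) (p : ℝ)
    {g : EuclideanSpace ℝ (Fin n) → ℝ} (hg : Continuous g) (hg0 : ∀ x, 0 < g x) {b : ℝ}
    (hb : ∫ x in frontier (K : Set (EuclideanSpace ℝ (Fin n))),
      g x ^ p * supportFunction K (gaussMap K x) ^ (1 - p) ∂μHE[n - 1] < b) :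
    ∀ᶠ L : ConvexBody (EuclideanSpace ℝ (Fin n)) in
      𝓝[{L : ConvexBody (EuclideanSpace ℝ (Fin n)) |
        (0 : EuclideanSpace ℝ (Fin n)) ∈ interior (L : Set (EuclideanSpace ℝ (Fin n)))}] K,
      ∫ x in frontier (L : Set (EuclideanSpace ℝ (Fin n))),
        g x ^ p * supportFunction L (gaussMap L x) ^ (1 - p) ∂μHE[n - 1] < b := by
  set l := 𝓝[{L : ConvexBody (EuclideanSpace ℝ (Fin n)) |
    (0 : EuclideanSpace ℝ (Fin n)) ∈ interior (L : Set (EuclideanSpace ℝ (Fin n)))}] K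
  have hL : Tendsto id l (𝓝 K) := nhdsWithin_le_nhds
  have hl0 : ∀ᶠ L : ConvexBody (EuclideanSpace ℝ (Fin n)) in l,
      (0 : EuclideanSpace ℝ (Fin n)) ∈ interior (L : Set (EuclideanSpace ℝ (Fin n))) :=
    self_mem_nhdsWithin
  have hgp : Continuous fun x => g x ^ p := hg.rpow_const fun x => Or.inl (hg0 x).ne'
  have hgp0 : ∀ x, 0 < g x ^ p := fun x => Real.rpow_pos_of_pos (hg0 x) p
  obtain ⟨M, hM0, hM, hM'⟩ := exists_eventually_forall_norm_le hL hgp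
  obtain ⟨r, R, hr, hrR, hev⟩ := exists_eventually_supportFunction_mem_Icc hK
  have hw : ∀ L : ConvexBody (EuclideanSpace ℝ (Fin n)),
      (∀ u : EuclideanSpace ℝ (Fin n), ‖u‖ = 1 → supportFunction L u ∈ Icc r R) → ∀ x,
      supportFunction L (gaussMap L x) ^ (1 - p) ≤ r ^ (1 - p) + R ^ (1 - p) := by
    intro L hLr x
    by_cases hu : ∃! u, IsOuterUnitNormal L x u
    · exact rpow_le_add_of_mem_Icc hr (hLr _ (isOuterUnitNormal_gaussMap hu).2.1) _
    · exact (supportFunction_gaussMap_rpow_le _ hr fun h => absurd h hu).trans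
        (le_add_of_nonneg_right (Real.rpow_nonneg (hr.le.trans hrR) _))
  have hbd : ∀ L : ConvexBody (EuclideanSpace ℝ (Fin n)),
      (0 : EuclideanSpace ℝ (Fin n)) ∈ interior (L : Set (EuclideanSpace ℝ (Fin n))) →
      (∀ u : EuclideanSpace ℝ (Fin n), ‖u‖ = 1 → supportFunction L u ∈ Icc r R) →
      (∀ x ∈ L, ‖g x ^ p‖ ≤ M) → ∀ x ∈ frontier (L : Set (EuclideanSpace ℝ (Fin n))),
      0 ≤ g x ^ p * supportFunction L (gaussMap L x) ^ (1 - p) ∧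
      g x ^ p * supportFunction L (gaussMap L x) ^ (1 - p) ≤
        M * (r ^ (1 - p) + R ^ (1 - p)) := by
    intro L h0 hLr hLM x hx
    have hs := Real.rpow_nonneg (supportFunction_nonneg (interior_subset h0) (gaussMap L x)) (1 - p)
    exact ⟨mul_nonneg (hgp0 x).le hs, mul_le_mul
      ((le_abs_self _).trans (hLM x (mem_of_mem_frontier L hx))) (hw L hLr x) hs hM0⟩
  have hmeas : ∀ L : ConvexBody (EuclideanSpace ℝ (Fin n)),
      Measurable fun x => g x ^ p * supportFunction L (gaussMap L x) ^ (1 - p) := by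
    intro L
    obtain ⟨C, hC⟩ := exists_lipschitzWith_supportFunction L
    exact hgp.measurable.mul
      ((hC.continuous.measurable.comp (measurable_gaussMap L)).pow_const _)
  refine eventually_setIntegral_frontier_lt
    (G := fun L x => g x ^ p * supportFunction L (gaussMap L x) ^ (1 - p))
    (M := M * (r ^ (1 - p) + R ^ (1 - p))) hL ⟨0, hK⟩ (hl0.mono fun L hL => ⟨0, hL⟩)
    hmeas (hmeas K) ?_ (hbd K hK hev.self_of_nhds hM) ?_ hb
  · filter_upwards [hl0, nhdsWithin_le_nhds hev, hM'] with L h0 hLr hLM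
    exact hbd L h0 hLr hLM
  have hreg : ∀ᵐ x ∂(μHE[n - 1]).restrict (frontier (K : Set (EuclideanSpace ℝ (Fin n)))),
      x ∉ irregularPoints K :=
    ae_restrict_of_ae (measure_eq_zero_iff_ae_notMem.1 (measure_irregularPoints hK))
  filter_upwards [hreg, ae_restrict_mem isClosed_frontier.measurableSet] with x hx hxf y hy a ha
  obtain ⟨u, hu⟩ := exists_isOuterUnitNormal ⟨0, hK⟩ hxf
  have huniq : ∀ w, IsOuterUnitNormal K x w → w = u := fun w hw =>
    by_contra fun hne => hx ⟨w, u, hne, hw, hu⟩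
  have hgauss : gaussMap K x = u := huniq _ (isOuterUnitNormal_gaussMap ⟨u, hu, huniq⟩)
  rw [hgauss] at ha
  -- Restrict to those bodies `L` with `y L ∈ ∂L`, and select a normal there.
  refine (eventually_inf_principal (f := l)
    (s := {L : ConvexBody (EuclideanSpace ℝ (Fin n)) |
      y L ∈ frontier (L : Set (EuclideanSpace ℝ (Fin n)))})).1 ?_
  have hex : ∀ L : ConvexBody (EuclideanSpace ℝ (Fin n)), ∃ v : EuclideanSpace ℝ (Fin n),
      (0 : EuclideanSpace ℝ (Fin n)) ∈ interior (L : Set (EuclideanSpace ℝ (Fin n))) →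
      y L ∈ frontier (L : Set (EuclideanSpace ℝ (Fin n))) → IsOuterUnitNormal L (y L) v := by
    intro L
    by_cases h : (0 : EuclideanSpace ℝ (Fin n)) ∈ interior (L : Set (EuclideanSpace ℝ (Fin n))) ∧
      y L ∈ frontier (L : Set (EuclideanSpace ℝ (Fin n)))
    · obtain ⟨v, hv⟩ := exists_isOuterUnitNormal ⟨0, h.1⟩ h.2
      exact ⟨v, fun _ _ => hv⟩
    · exact ⟨0, fun h1 h2 => absurd ⟨h1, h2⟩ h⟩
  choose v hv using hex
  have hnormal : ∀ᶠ L in l ⊓ 𝓟 {L : ConvexBody (EuclideanSpace ℝ (Fin n)) |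
      y L ∈ frontier (L : Set (EuclideanSpace ℝ (Fin n)))},
      IsOuterUnitNormal L (y L) (v L) :=
    eventually_inf_principal.2 (hl0.mono fun L h0 hf => hv L h0 hf)
  have hL' := hL.mono_left
    (inf_le_left (b := 𝓟 {L : ConvexBody (EuclideanSpace ℝ (Fin n)) |
      y L ∈ frontier (L : Set (EuclideanSpace ℝ (Fin n)))}))
  have hy' := hy.mono_left
    (inf_le_left (b := 𝓟 {L : ConvexBody (EuclideanSpace ℝ (Fin n)) |
      y L ∈ frontier (L : Set (EuclideanSpace ℝ (Fin n)))}))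
  have hupos : 0 < supportFunction K u := hr.trans_le (hev.self_of_nhds u hu.2.1).1
  have hlim := tendsto_supportFunction hL' (tendsto_normal hL' hy' hnormal huniq)
  have hlim2 := ((hgp.tendsto x).comp hy').mul
    (hlim.rpow_const (p := 1 - p) (Or.inl hupos.ne'))
  filter_upwards [hlim2.eventually_lt_const ha, hnormal, hlim.eventually_const_lt hupos]
    with L h1 h2 h3
  refine lt_of_le_of_lt (mul_le_mul_of_nonneg_left ?_ (hgp0 _).le) h1
  refine supportFunction_gaussMap_rpow_le _ h3 fun hex => le_of_eq ?_
  rw [hex.unique (isOuterUnitNormal_gaussMap hex) h2]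
  rfl

end LpAffine

theorem theorem3p3 (n : ℕ) (hn : 1 ≤ n) :
    (∀ p : ℝ, 0 < p →
      UpperSemicontinuousOn
        (fun K : ConvexBody (EuclideanSpace ℝ (Fin n)) => LpAffine.lpAffineSurfaceArea p K)
        {K : ConvexBody (EuclideanSpace ℝ (Fin n)) |
          (0 : EuclideanSpace ℝ (Fin n)) ∈ interior (K : Set (EuclideanSpace ℝ (Fin n)))}) ∧
    UpperSemicontinuousOn
      (fun K : ConvexBody (EuclideanSpace ℝ (Fin n)) => LpAffine.affineSurfaceArea K)
      {K : ConvexBody (EuclideanSpace ℝ (Fin n)) |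
        (interior (K : Set (EuclideanSpace ℝ (Fin n)))).Nonempty} := by
  have hn0 : (0 : ℝ) < n := by exact_mod_cast hn
  refine ⟨fun p hp => ?_, ?_⟩
  · refine LpAffine.upperSemicontinuousOn_iInf_mul_rpow
      (A := fun K g => ∫ x in frontier (K : Set (EuclideanSpace ℝ (Fin n))), g x ^ (-(n : ℝ))
        ∂(LpAffine.curvatureMeasureZero K))
      (B := fun K g => ∫ x in frontier (K : Set (EuclideanSpace ℝ (Fin n))), g x ^ p *
        LpAffine.supportFunction K (LpAffine.gaussMap K x) ^ (1 - p)
        ∂(LpAffine.curvatureMeasureTop K))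
      (by positivity) (by positivity)
      (fun K _ g hg => setIntegral_nonneg isClosed_frontier.measurableSet fun x hx =>
        Real.rpow_nonneg (hg.2 x hx).le _)
      (fun K hK g hg => setIntegral_nonneg isClosed_frontier.measurableSet fun x hx =>
        mul_nonneg (Real.rpow_nonneg (hg.2 x hx).le _)
          (Real.rpow_nonneg (LpAffine.supportFunction_nonneg (interior_subset hK) _) _))
      (fun K g g' h => LpAffine.setIntegral_congr_frontier K _ h fun _ t => t ^ (-(n : ℝ)))
      (fun K g g' h => LpAffine.setIntegral_congr_frontier K _ h fun x t => t ^ p *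
        LpAffine.supportFunction K (LpAffine.gaussMap K x) ^ (1 - p))
      (fun K _ g hg hg0 a ha => LpAffine.eventually_setIntegral_zero_lt hg hg0 ha) ?_
    intro K hK g hg hg0 b hb
    simp only [LpAffine.setIntegral_curvatureMeasureTop] at hb ⊢
    exact LpAffine.eventually_setIntegral_top_weighted_lt hK p hg hg0 hb
  · refine LpAffine.upperSemicontinuousOn_iInf_mul_rpow
      (A := fun K g => ∫ x in frontier (K : Set (EuclideanSpace ℝ (Fin n))), g x ^ (-(n : ℝ))
        ∂(LpAffine.curvatureMeasureZero K))
      (B := fun K g => ∫ x in frontier (K : Set (EuclideanSpace ℝ (Fin n))), g x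
        ∂(LpAffine.curvatureMeasureTop K))
      (by positivity) (by positivity)
      (fun K _ g hg => setIntegral_nonneg isClosed_frontier.measurableSet fun x hx =>
        Real.rpow_nonneg (hg.2 x hx).le _)
      (fun K _ g hg => setIntegral_nonneg isClosed_frontier.measurableSet fun x hx =>
        (hg.2 x hx).le)
      (fun K g g' h => LpAffine.setIntegral_congr_frontier K _ h fun _ t => t ^ (-(n : ℝ)))
      (fun K g g' h => LpAffine.setIntegral_congr_frontier K _ h fun _ t => t)
      (fun K _ g hg hg0 a ha => LpAffine.eventually_setIntegral_zero_lt hg hg0 ha) ?_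
    intro K hK g hg hg0 b hb
    simp only [LpAffine.setIntegral_curvatureMeasureTop] at hb ⊢
    exact LpAffine.eventually_setIntegral_top_lt hK hg hg0 hb
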